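/- Let $\phi=1_{[0,1]}$ and $\psi=1_{[0,1/2]}-1_{(1/2,1]}$. For $\lambda=(j,k)\in\Lambda=\{(j,k)\in\mathbb Z^2: j\ge -1\}$ let $\varphi_\lambda(x)=\phi(x-k)$ if $j=-1$ and $\varphi_\lambda(x)=2^{j/2}\psi(2^jx-k)$ if $j\ge 0$ (the Haar basis of $L_2(\mathbb R)$). For a positive integer $n$ and an integrable $f\ge 0$ on $\mathbb R$, let $N$ be a Poisson process on $\mathbb R$ with mean measure $n f(x)\,dx$, i.e. a random countable subset of $\mathbb R$ such that the number of points in any Borel set $A$ is Poisson distributed with mean $n\int_A f$ and the numbers of points in finitely many disjoint Borel sets are independent. Put $$\beta_\lambda=\int\varphi_\lambda f,\qquad V_{\lambda,n}=\frac1n\int\varphi_\lambda^2 f,\qquad F_\lambda=\int_{\{\varphi_\lambda\ne 0\}}f,\qquad \hat\beta_\lambda=\frac1n\sum_{T\in N}\varphi_\lambda(T),\qquad \hat V_{\lambda,n}=\frac1{n^2}\sum_{T\in N}\varphi_\lambda(T)^2,$$ so that $V_{\lambda,n}=\mathrm{Var}(\hat\beta_\lambda)$. For $\gamma>0$ put $$\tilde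 V_{\lambda,n}=\hat V_{\lambda,n}+\sqrt{2\gamma\ln n\,\hat V_{\lambda,n}\frac{\|\varphi_\lambda\|_\infty^2}{n^2}}+3\gamma\ln n\frac{\|\varphi_\lambda\|_\infty^2}{n^2},\qquad \eta_{\lambda,\gamma}=\sqrt{2\gamma\tilde V_{\lambda,n}\ln n}+\frac{\gamma\ln n}{3n}\|\varphi_\lambda\|_\infty .$$ Let $\Gamma_n=\{(j,k)\in\Lambda: j\le j_0\}$, where $j_0$ is the integer with $2^{j_0}\le n<2^{j_0+1}$, and $$\tilde f_{n,\gamma}=\sum_{\lambda\in\Gamma_n}\hat\beta_\lambda\,1_{\{|\hat\beta_\lambda|\ge\eta_{\lambda,\gamma}\}}\,\varphi_\lambda .$$ For $R>0$ let $\mathcal F_n(R)$ be the set of all $f\ge 0$ on $\mathbb R$ with $\|f\|_1\le R$, $\|f\|_2\le R$, $\|f\|_\infty\le R$ and, for every $\lambda\in\Lambda$ with $\beta_\lambda\ne 0$, $F_\lambda\ge\frac{(\ln n)(\ln\ln n)}{n}$. Theorem. Let $R>0$ and $\gamma=1+\sqrt2$. There is $n_0$ depending only on $R$ such that for every $n\ge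 n_0$ and every $f\in\mathcal F_n(R)$, $$\mathbb E\bigl(\|\tilde f_{n,\gamma}-f\|_2^2\bigr)\le 12\ln n\Bigl[\sum_{\lambda\in\Gamma_n}\min(\beta_\lambda^2,V_{\lambda,n})+\frac1n\Bigr],$$ where the sum on the right is finite. -/

import Mathlib

open MeasureTheory ProbabilityTheory Filter
open scoped ENNReal

noncomputable section

/-! ### The Haar basis -/

/-- The father wavelet `1_{[0,1]}`. -/
def haarFather (x : ℝ) : ℝ := (Set.Icc (0 : ℝ) 1).indicator 1 x

/-- The mother wavelet `1_{[0,1/2]} - 1_{(1/2,1]}`. -/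
def haarMother (x : ℝ) : ℝ :=
  (Set.Icc (0 : ℝ) (1 / 2)).indicator 1 x - (Set.Ioc (1 / 2 : ℝ) 1).indicator 1 x

/-- The index set `{(j, k) : j ≥ -1, k ∈ ℤ}`. -/
abbrev HaarIndex : Type := {l : ℤ × ℤ // -1 ≤ l.1}

/-- The scale `j` of the index `(j, k)`. -/
def HaarIndex.scale (l : HaarIndex) : ℤ := l.1.1

/-- The translation `k` of the index `(j, k)`. -/
def HaarIndex.shift (l : HaarIndex) : ℤ := l.1.2

/-- The Haar function with index `(j, k)`: `φ(x - k)` if `j = -1`, and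
`2^{j/2} ψ(2^j x - k)` if `j ≥ 0`. -/
def haar (l : HaarIndex) (x : ℝ) : ℝ :=
  if l.scale = -1 then haarFather (x - (l.shift : ℝ))
  else (2 : ℝ) ^ ((l.scale : ℝ) / 2) * haarMother ((2 : ℝ) ^ l.scale * x - (l.shift : ℝ))

/-- The sup-norm of a Haar function. -/
def haarSupNorm (l : HaarIndex) : ℝ := (eLpNorm (haar l) ∞ volume).toReal

/-- The indices with `j ≤ j₀`, where `j₀ = Nat.log 2 n` is the integer such that
`2^{j₀} ≤ n < 2^{j₀+1}` (for `n ≥ 1`). -/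
def haarGamma (n : ℕ) : Set HaarIndex := {l | l.scale ≤ (Nat.log 2 n : ℤ)}

/-! ### Quantities attached to the intensity -/

/-- The Haar coefficient `β_λ = ∫ φ_λ f`. -/
def haarCoeff (f : ℝ → ℝ) (l : HaarIndex) : ℝ := ∫ x, haar l x * f x

/-- The variance `V_{λ,n} = (1/n) ∫ φ_λ² f` of the empirical coefficient. -/
def haarVar (n : ℕ) (f : ℝ → ℝ) (l : HaarIndex) : ℝ := (1 / (n : ℝ)) * ∫ x, haar l x ^ 2 * f x

/-- The mass `F_λ` of `f` on `{x : φ_λ(x) ≠ 0}`. -/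
def haarMass (f : ℝ → ℝ) (l : HaarIndex) : ℝ := ∫ x in Function.support (haar l), f x

/-- The class `𝓕_n(R)`: nonnegative functions in the balls of radius `R` of `L¹`, `L²` and `L^∞`
with `F_λ ≥ (ln n)(ln ln n)/n` whenever `β_λ ≠ 0`. -/
def haarClass (n : ℕ) (R : ℝ) : Set (ℝ → ℝ) :=
  {f | (0 ≤ᵐ[volume] f) ∧
    (MemLp f 1 volume ∧ eLpNorm f 1 volume ≤ ENNReal.ofReal R) ∧
    (MemLp f 2 volume ∧ eLpNorm f 2 volume ≤ ENNReal.ofReal R) ∧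
    (MemLp f ∞ volume ∧ eLpNorm f ∞ volume ≤ ENNReal.ofReal R) ∧
    ∀ l : HaarIndex, haarCoeff f l ≠ 0 →
      Real.log n * Real.log (Real.log n) / n ≤ haarMass f l}

/-! ### Poisson processes -/

/-- The Poisson distribution on `ℕ∞` with mean `m ∈ [0, ∞]`; for `m = ∞` it is the point mass
at `∞`. -/
def poissonLaw (m : ℝ≥0∞) : Measure ℕ∞ :=
  if m = ∞ then Measure.dirac ⊤
  else (poissonMeasure m.toNNReal).map (fun k : ℕ => (k : ℕ∞))

/-- `N` is a Poisson process on `X` with mean measure `μ`: a random countable subset of `X` such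
that the number of points in each measurable set `A` is a random variable with the Poisson
distribution of mean `μ A`, and the numbers of points in finitely many disjoint measurable sets
are independent. -/
structure IsPoissonProcess {Ω X : Type*} [MeasurableSpace Ω] [MeasurableSpace X]
    (N : Ω → Set X) (μ : Measure X) (P : Measure Ω) : Prop where
  countable : ∀ ω, (N ω).Countable
  measurable_count : ∀ A : Set X, MeasurableSet A → Measurable (fun ω => (N ω ∩ A).encard)
  law_count : ∀ A : Set X, MeasurableSet A →
    P.map (fun ω => (N ω ∩ A).encard) = poissonLaw (μ A)
  indep_count : ∀ (m : ℕ) (A : Fin m → Set X), (∀ i, MeasurableSet (A i)) →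
    Pairwise (fun i j => Disjoint (A i) (A j)) →
    iIndepFun (fun (i : Fin m) (ω : Ω) => (N ω ∩ A i).encard) P

/-- The measure `n f(x) dx`. -/
def intensityMeasure (n : ℕ) (f : ℝ → ℝ) : Measure ℝ :=
  volume.withDensity (fun x => ENNReal.ofReal ((n : ℝ) * f x))

/-! ### The thresholding estimator, as a function of the observed point set `S` -/

/-- The integral `∫ g dN = ∑_{T ∈ S} g(T)`. -/
def pointSum (S : Set ℝ) (g : ℝ → ℝ) : ℝ := ∑' T : S, g (T : ℝ)

/-- The empirical coefficient `β̂_λ`. -/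
def betaHat (n : ℕ) (S : Set ℝ) (l : HaarIndex) : ℝ := (1 / (n : ℝ)) * pointSum S (haar l)

/-- The variance estimate `V̂_{λ,n}`. -/
def vHat (n : ℕ) (S : Set ℝ) (l : HaarIndex) : ℝ :=
  (1 / (n : ℝ) ^ 2) * pointSum S (fun x => haar l x ^ 2)

/-- The overestimate `Ṽ_{λ,n}` of the variance. -/
def vTilde (n : ℕ) (γ : ℝ) (S : Set ℝ) (l : HaarIndex) : ℝ :=
  vHat n S l
    + √(2 * γ * Real.log n * vHat n S l * (haarSupNorm l ^ 2 / (n : ℝ) ^ 2))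
    + 3 * γ * Real.log n * (haarSupNorm l ^ 2 / (n : ℝ) ^ 2)

/-- The data-driven threshold `η_{λ,γ}`. -/
def threshold (n : ℕ) (γ : ℝ) (S : Set ℝ) (l : HaarIndex) : ℝ :=
  √(2 * γ * vTilde n γ S l * Real.log n) + γ * Real.log n / (3 * (n : ℝ)) * haarSupNorm l

open Classical in
/-- The thresholded coefficient `β̃_λ`. -/
def betaTilde (n : ℕ) (γ : ℝ) (S : Set ℝ) (l : HaarIndex) : ℝ :=
  if l ∈ haarGamma n ∧ threshold n γ S l ≤ |betaHat n S l| then betaHat n S l else 0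

/-- The estimator `f̃_{n,γ} = ∑_λ β̃_λ φ_λ`. At each point `x` only finitely many terms are
nonzero, because `β̃_λ = 0` for scales above `j₀`. -/
def haarEstimator (n : ℕ) (γ : ℝ) (S : Set ℝ) (x : ℝ) : ℝ :=
  ∑' l : HaarIndex, betaTilde n γ S l * haar l x

/-- The squared `L²` loss `‖f̃_{n,γ} - f‖₂²`, with values in `[0, ∞]`. -/
def haarLoss (n : ℕ) (γ : ℝ) (f : ℝ → ℝ) (S : Set ℝ) : ℝ≥0∞ :=
  eLpNorm (fun x => haarEstimator n γ S x - f x) 2 volume ^ 2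

end

/-! ### Poisson weights -/

/-- The Poisson probability `e^{-a} a^i / i!`. -/
noncomputable def poissonWeight (a : ℝ) (i : ℕ) : ℝ := Real.exp (-a) * a ^ i / (i.factorial : ℝ)

lemma poissonWeight_nonneg {a : ℝ} (ha : 0 ≤ a) (i : ℕ) : 0 ≤ poissonWeight a i := by
  unfold poissonWeight; positivity

lemma hasSum_poissonWeight {a : ℝ} (ha : 0 ≤ a) : HasSum (poissonWeight a) 1 :=
  hasSum_one_poissonMeasure ⟨a, ha⟩

lemma poissonWeight_succ_mul (a : ℝ) (i : ℕ) :
    poissonWeight a (i + 1) * ((i + 1 : ℕ) : ℝ) = a * poissonWeight a i := by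
  unfold poissonWeight
  rw [Nat.factorial_succ]
  push_cast
  have : (i.factorial : ℝ) ≠ 0 := by positivity
  have : (i : ℝ) + 1 ≠ 0 := by positivity
  field_simp
  ring

lemma hasSum_poissonWeight_mul {a : ℝ} (ha : 0 ≤ a) :
    HasSum (fun i : ℕ => poissonWeight a i * (i : ℝ)) a := by
  rw [← hasSum_nat_add_iff' 1]
  simp only [Finset.range_one, Finset.sum_singleton, CharP.cast_eq_zero, mul_zero, sub_zero,
    poissonWeight_succ_mul]
  simpa using (hasSum_poissonWeight ha).mul_left a

lemma hasSum_poissonWeight_mul_sq {a : ℝ} (ha : 0 ≤ a) :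
    HasSum (fun i : ℕ => poissonWeight a i * (i : ℝ) ^ 2) (a + a ^ 2) := by
  rw [← hasSum_nat_add_iff' 1]
  have h := ((hasSum_poissonWeight_mul ha).add (hasSum_poissonWeight ha)).mul_left a
  have h2 : (fun i : ℕ => poissonWeight a (i + 1) * ((i + 1 : ℕ) : ℝ) ^ 2)
      = fun i : ℕ => a * (poissonWeight a i * i + poissonWeight a i) := by
    ext i
    rw [pow_two, ← mul_assoc, poissonWeight_succ_mul]
    push_cast
    ring
  rw [h2]
  have h3 : a + a ^ 2 - ∑ i ∈ Finset.range 1, poissonWeight a i * (i : ℝ) ^ 2 = a * (a + 1) := by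
    simp
    ring
  rw [h3]
  exact h

lemma sinh_le_mul_cosh {s : ℝ} (hs : 0 ≤ s) : Real.sinh s ≤ s * Real.cosh s := by
  have hd : ∀ x : ℝ, HasDerivAt (fun x => x * Real.cosh x - Real.sinh x) (x * Real.sinh x) x := by
    intro x
    have h := ((hasDerivAt_id x).mul (Real.hasDerivAt_cosh x)).sub (Real.hasDerivAt_sinh x)
    exact h.congr_deriv (by simp)
  have hm : MonotoneOn (fun x => x * Real.cosh x - Real.sinh x) (Set.Ici 0) := by
    apply monotoneOn_of_deriv_nonneg (convex_Ici 0)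
    · exact fun x _ => (hd x).continuousAt.continuousWithinAt
    · exact fun x _ => (hd x).differentiableAt.differentiableWithinAt
    · intro x hx
      rw [interior_Ici] at hx
      rw [(hd x).deriv]
      exact mul_nonneg (le_of_lt hx) (Real.sinh_nonneg_iff.2 (le_of_lt hx))
  have := hm (Set.mem_Ici.2 le_rfl) hs hs
  simpa using this

lemma cosh_add_mul_sinh_le {s δ : ℝ} (hs : 0 ≤ s) (hδ : 0 ≤ δ) :
    Real.cosh s + δ * Real.sinh s ≤ Real.exp (s ^ 2 / 2 + δ * s) := by
  calc Real.cosh s + δ * Real.sinh s ≤ Real.cosh s + δ * (s * Real.cosh s) := by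
        gcongr; exact sinh_le_mul_cosh hs
    _ = Real.cosh s * (δ * s + 1) := by ring
    _ ≤ Real.exp (s ^ 2 / 2) * Real.exp (δ * s) := by
        have := Real.add_one_le_exp (δ * s)
        have := Real.cosh_le_exp_half_sq s
        gcongr
    _ = _ := by rw [← Real.exp_add]

lemma exp_tilt_le {a b δ s : ℝ} (ha : 0 ≤ a) (hb : 0 ≤ b) (hδ : 0 ≤ δ)
    (hd : |a - b| ≤ δ * (a + b)) (hs : 0 ≤ s) :
    a * Real.exp s + b * Real.exp (-s) ≤ (a + b) * Real.exp (s ^ 2 / 2 + δ * s) := by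
  have h : a * Real.exp s + b * Real.exp (-s)
      = (a + b) * Real.cosh s + (a - b) * Real.sinh s := by
    rw [Real.cosh_eq, Real.sinh_eq]; ring
  rw [h]
  calc (a + b) * Real.cosh s + (a - b) * Real.sinh s
      ≤ (a + b) * Real.cosh s + (δ * (a + b)) * Real.sinh s := by
        have := Real.sinh_nonneg_iff.2 hs
        have := (le_abs_self _).trans hd
        gcongr
    _ = (a + b) * (Real.cosh s + δ * Real.sinh s) := by ring
    _ ≤ _ := by
        have := cosh_add_mul_sinh_le hs hδ
        gcongr

/-- The law of the pair conditioned on its sum, tilted exponentially in the difference. -/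
lemma sum_antidiagonal_poissonWeight_mul_exp (a b s : ℝ) (x : ℕ) :
    ∑ p ∈ Finset.HasAntidiagonal.antidiagonal x, poissonWeight a p.1 * poissonWeight b p.2 *
        Real.exp (s * ((p.1 : ℝ) - p.2))
      = Real.exp (-(a + b)) * (a * Real.exp s + b * Real.exp (-s)) ^ x / (x.factorial : ℝ) := by
  rw [(Commute.all _ _).add_pow', Finset.mul_sum, Finset.sum_div]
  refine Finset.sum_congr rfl fun p hp => ?_
  have hp' : p.1 + p.2 = x := Finset.HasAntidiagonal.mem_antidiagonal.1 hp
  subst hp'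
  rw [mul_pow, mul_pow, ← Real.exp_nat_mul, ← Real.exp_nat_mul, nsmul_eq_mul,
    Nat.cast_add_choose]
  unfold poissonWeight
  rw [neg_add, Real.exp_add, mul_sub, sub_eq_add_neg, Real.exp_add, mul_comm s p.1,
    ← mul_neg, mul_comm s (-(p.2 : ℝ)), neg_mul, ← mul_neg]
  have h1 : ((p.1 + p.2).factorial : ℝ) ≠ 0 := by positivity
  have h2 : (p.1.factorial : ℝ) ≠ 0 := by positivity
  have h3 : (p.2.factorial : ℝ) ≠ 0 := by positivity
  field_simp

lemma sum_antidiagonal_exp_le {a b δ s : ℝ} (ha : 0 ≤ a) (hb : 0 ≤ b) (hδ : 0 ≤ δ)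
    (hd : |a - b| ≤ δ * (a + b)) (hs : 0 ≤ s) (x : ℕ) :
    ∑ p ∈ Finset.HasAntidiagonal.antidiagonal x, poissonWeight a p.1 * poissonWeight b p.2 *
        (Real.exp (s * ((p.1 : ℝ) - p.2)) + Real.exp (-s * ((p.1 : ℝ) - p.2)))
      ≤ 2 * (Real.exp (-(a + b)) * (a + b) ^ x / (x.factorial : ℝ) *
          Real.exp (x * (s ^ 2 / 2 + δ * s))) := by
  have key : ∀ c : ℝ, 0 ≤ c → c ≤ (a + b) * Real.exp (s ^ 2 / 2 + δ * s) →
      Real.exp (-(a + b)) * c ^ x / (x.factorial : ℝ) ≤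
        Real.exp (-(a + b)) * (a + b) ^ x / (x.factorial : ℝ) *
          Real.exp (x * (s ^ 2 / 2 + δ * s)) := by
    intro c hc0 hc
    rw [Real.exp_nat_mul, div_mul_eq_mul_div, mul_assoc, ← mul_pow]
    gcongr
  simp_rw [mul_add (poissonWeight a _ * _), Finset.sum_add_distrib]
  rw [sum_antidiagonal_poissonWeight_mul_exp, sum_antidiagonal_poissonWeight_mul_exp, two_mul]
  refine add_le_add ?_ ?_
  · exact key _ (by positivity) (exp_tilt_le ha hb hδ hd hs)
  · have h := exp_tilt_le hb ha hδ (by rwa [abs_sub_comm, add_comm b a]) hs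
    rw [neg_neg, add_comm (a * _)]
    rw [add_comm b a] at h
    have := key _ (by positivity) h
    exact this

/-- The mean of `G (A, B)` for independent Poisson variables `A`, `B` of means `a`, `b`. -/
noncomputable def poissonPairMean (a b : ℝ) (G : ℕ × ℕ → ℝ≥0∞) : ℝ≥0∞ :=
  ∑' p : ℕ × ℕ, ENNReal.ofReal (poissonWeight a p.1 * poissonWeight b p.2) * G p

lemma poissonPairMean_mono {a b : ℝ} {G H : ℕ × ℕ → ℝ≥0∞} (h : ∀ p, G p ≤ H p) :
    poissonPairMean a b G ≤ poissonPairMean a b H :=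
  ENNReal.tsum_le_tsum fun p => by gcongr; exact h p

lemma poissonPairMean_add (a b : ℝ) (G H : ℕ × ℕ → ℝ≥0∞) :
    poissonPairMean a b (fun p => G p + H p) = poissonPairMean a b G + poissonPairMean a b H := by
  simp only [poissonPairMean, mul_add, ENNReal.tsum_add]

lemma tsum_ofReal_poissonWeight {a : ℝ} (ha : 0 ≤ a) :
    ∑' i, ENNReal.ofReal (poissonWeight a i) = 1 := by
  rw [← ENNReal.ofReal_tsum_of_nonneg (poissonWeight_nonneg ha) (hasSum_poissonWeight ha).summable,
    (hasSum_poissonWeight ha).tsum_eq, ENNReal.ofReal_one]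

lemma poissonPairMean_fst {a b : ℝ} (ha : 0 ≤ a) (hb : 0 ≤ b) (g : ℕ → ℝ≥0∞) :
    poissonPairMean a b (fun p => g p.1) = ∑' i, ENNReal.ofReal (poissonWeight a i) * g i := by
  rw [poissonPairMean, ENNReal.tsum_prod']
  refine tsum_congr fun i => ?_
  simp_rw [ENNReal.ofReal_mul (poissonWeight_nonneg ha i), mul_right_comm _ _ (g i)]
  rw [ENNReal.tsum_mul_left, tsum_ofReal_poissonWeight hb, mul_one]

lemma poissonPairMean_swap (a b : ℝ) (G : ℕ × ℕ → ℝ≥0∞) :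
    poissonPairMean a b (fun p => G p.swap) = poissonPairMean b a G := by
  rw [poissonPairMean, poissonPairMean, ← (Equiv.prodComm ℕ ℕ).tsum_eq]
  simp [mul_comm]

lemma poissonPairMean_snd {a b : ℝ} (ha : 0 ≤ a) (hb : 0 ≤ b) (g : ℕ → ℝ≥0∞) :
    poissonPairMean a b (fun p => g p.2) = ∑' i, ENNReal.ofReal (poissonWeight b i) * g i := by
  rw [← poissonPairMean_fst hb ha, ← poissonPairMean_swap]
  rfl

lemma tsum_poissonWeight_mul_ofReal {a s : ℝ} (ha : 0 ≤ a) {g : ℕ → ℝ} (hg : ∀ i, 0 ≤ g i)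
    (hs : HasSum (fun i => poissonWeight a i * g i) s) :
    ∑' i, ENNReal.ofReal (poissonWeight a i) * ENNReal.ofReal (g i) = ENNReal.ofReal s := by
  simp_rw [← ENNReal.ofReal_mul (poissonWeight_nonneg ha _)]
  rw [← ENNReal.ofReal_tsum_of_nonneg
    (fun i => mul_nonneg (poissonWeight_nonneg ha i) (hg i)) hs.summable, hs.tsum_eq]

lemma poissonPairMean_const {a b : ℝ} (ha : 0 ≤ a) (hb : 0 ≤ b) (c : ℝ≥0∞) :
    poissonPairMean a b (fun _ => c) = c := by
  rw [poissonPairMean_fst ha hb (fun _ => c), ENNReal.tsum_mul_right, tsum_ofReal_poissonWeight ha,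
    one_mul]

/-- The mean of a centred quadratic plus an affine function of a Poisson variable. -/
lemma hasSum_poissonWeight_mul_quadratic {a : ℝ} (ha : 0 ≤ a) (u v w : ℝ) :
    HasSum (fun i : ℕ => poissonWeight a i * (u * ((i : ℝ) - a) ^ 2 + v * i + w))
      (u * a + v * a + w) := by
  have h := (((hasSum_poissonWeight_mul_sq ha).mul_left u).add
    ((hasSum_poissonWeight_mul ha).mul_left (v - 2 * u * a))).add
    ((hasSum_poissonWeight ha).mul_left (u * a ^ 2 + w))
  have e : u * (a + a ^ 2) + (v - 2 * u * a) * a + (u * a ^ 2 + w) * 1 = u * a + v * a + w := by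
    ring
  rw [e] at h
  have e' : (fun i : ℕ => poissonWeight a i * (u * ((i : ℝ) - a) ^ 2 + v * i + w))
      = fun i : ℕ => u * (poissonWeight a i * (i : ℝ) ^ 2)
        + (v - 2 * u * a) * (poissonWeight a i * i) + (u * a ^ 2 + w) * poissonWeight a i := by
    ext i
    ring
  rw [e']
  exact h

/-! ### Thresholding a difference of two Poisson variables -/

/-- The threshold in units of `‖φ_λ‖_∞ / n`, as a function of the number `x` of points in the
support. -/
noncomputable def countThreshold (γ L x : ℝ) : ℝ :=
  √(2 * γ * (x + √(2 * γ * L * x) + 3 * γ * L) * L) + γ * L / 3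

/-- The squared error, in the same units, of the thresholded difference as an estimate of `d`. -/
noncomputable def countLoss (γ L d : ℝ) (p : ℕ × ℕ) : ℝ :=
  ((if countThreshold γ L ((p.1 : ℝ) + p.2) ≤ |(p.1 : ℝ) - p.2| then (p.1 : ℝ) - p.2 else 0) - d) ^ 2

lemma countThreshold_pos {γ L x : ℝ} (hγ : 0 < γ) (hL : 0 < L) : 0 < countThreshold γ L x := by
  unfold countThreshold; positivity

lemma sqrt_le_countThreshold {γ L x : ℝ} (hγ : 0 ≤ γ) (hL : 0 ≤ L) :
    √(2 * γ * L * x) ≤ countThreshold γ L x := by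
  unfold countThreshold
  have h : √(2 * γ * L * x) ≤ √(2 * γ * (x + √(2 * γ * L * x) + 3 * γ * L) * L) := by
    apply Real.sqrt_le_sqrt
    have : 0 ≤ 2 * γ * (√(2 * γ * L * x) + 3 * γ * L) * L := by positivity
    linarith
  have : 0 ≤ γ * L / 3 := by positivity
  linarith

lemma countThreshold_sq_le {L x : ℝ} (hL : 0 ≤ L) (hx : 0 ≤ x) :
    countThreshold (1 + √2) L x ^ 2 ≤ 5.36 * L * x + 175 * L ^ 2 := by
  have h2 : √2 ≤ 1.4143 := Real.sqrt_le_iff.2 (by norm_num)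
  have h2' : 0 ≤ √2 := Real.sqrt_nonneg 2
  set γ := 1 + √2 with hγ
  have hγ1 : γ ≤ 2.4143 := by linarith
  have hγ0 : 0 < γ := by linarith
  set r := √(2 * γ * L * x) with hr
  have hr0 : 0 ≤ r := Real.sqrt_nonneg _
  have hr2 : r ^ 2 = 2 * γ * L * x := Real.sq_sqrt (by positivity)
  have hr1 : r ≤ x / 20 + 10 * γ * L := by
    refine Real.sqrt_le_iff.2 ⟨by positivity, ?_⟩
    nlinarith [sq_nonneg (x / 20 - 10 * γ * L)]
  set t := √(2 * γ * (x + r + 3 * γ * L) * L) with ht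
  have ht2 : t ^ 2 = 2 * γ * (x + r + 3 * γ * L) * L := Real.sq_sqrt (by positivity)
  have hc : countThreshold γ L x = t + γ * L / 3 := rfl
  rw [hc]
  have h1 : (t + γ * L / 3) ^ 2 ≤ 1.05 * t ^ 2 + 21 * (γ * L / 3) ^ 2 := by
    nlinarith [sq_nonneg (t - 20 * (γ * L / 3))]
  have h3 : t ^ 2 ≤ 2 * γ * (1.05 * x + 13 * γ * L) * L := by
    have h : x + r + 3 * γ * L ≤ 1.05 * x + 13 * γ * L := by linarith
    rw [ht2]
    exact mul_le_mul_of_nonneg_right (mul_le_mul_of_nonneg_left h (by positivity)) hL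
  have h4 : γ ^ 2 ≤ 5.83 := by nlinarith
  have h5 : γ * (L * x) ≤ 2.4143 * (L * x) := by gcongr
  have h6 : γ ^ 2 * L ^ 2 ≤ 5.83 * L ^ 2 := by gcongr
  nlinarith

lemma countLoss_le_quadratic {L d a b : ℝ} (hL : 0 ≤ L) (hd : d = a - b) (p : ℕ × ℕ) :
    countLoss (1 + √2) L d p ≤
      (6 * ((p.1 : ℝ) - a) ^ 2 + 10.72 * L * p.1 + 350 * L ^ 2)
        + (6 * ((p.2 : ℝ) - b) ^ 2 + 10.72 * L * p.2 + 0) := by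
  have hx : (0 : ℝ) ≤ (p.1 : ℝ) + p.2 := by positivity
  have ht := countThreshold_sq_le hL hx
  have hp1 : 0 ≤ L * (p.1 : ℝ) := by positivity
  have hp2 : 0 ≤ L * (p.2 : ℝ) := by positivity
  have hq : ((p.1 : ℝ) - p.2 - d) ^ 2 ≤ 2 * ((p.1 : ℝ) - a) ^ 2 + 2 * ((p.2 : ℝ) - b) ^ 2 := by
    rw [hd]
    nlinarith [sq_nonneg (((p.1 : ℝ) - a) + ((p.2 : ℝ) - b))]
  unfold countLoss
  split_ifs with h
  · nlinarith [sq_nonneg ((p.1 : ℝ) - a), sq_nonneg ((p.2 : ℝ) - b), sq_nonneg L]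
  · push Not at h
    have h1 : (0 - d) ^ 2 ≤ 2 * ((p.1 : ℝ) - p.2 - d) ^ 2 + 2 * |(p.1 : ℝ) - p.2| ^ 2 := by
      rw [sq_abs]
      nlinarith [sq_nonneg (2 * ((p.1 : ℝ) - p.2) - d)]
    have h2 : |(p.1 : ℝ) - p.2| ^ 2 ≤ countThreshold (1 + √2) L ((p.1 : ℝ) + p.2) ^ 2 := by
      gcongr
    nlinarith [sq_nonneg ((p.1 : ℝ) - a), sq_nonneg ((p.2 : ℝ) - b), sq_nonneg L]

lemma poissonPairMean_countLoss_le_of_large {L a b : ℝ} (hL : 10 ≤ L) (ha : 0 ≤ a) (hb : 0 ≤ b)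
    (hm : 1000 * L ≤ a + b) :
    poissonPairMean a b (fun p => ENNReal.ofReal (countLoss (1 + √2) L (a - b) p))
      ≤ ENNReal.ofReal (12 * L * (a + b)) := by
  have hL0 : 0 ≤ L := by linarith
  calc _ ≤ poissonPairMean a b (fun p =>
        ENNReal.ofReal (6 * ((p.1 : ℝ) - a) ^ 2 + 10.72 * L * p.1 + 350 * L ^ 2)
        + ENNReal.ofReal (6 * ((p.2 : ℝ) - b) ^ 2 + 10.72 * L * p.2 + 0)) := by
        refine poissonPairMean_mono fun p => ?_
        rw [← ENNReal.ofReal_add (by positivity) (by positivity)]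
        exact ENNReal.ofReal_le_ofReal (countLoss_le_quadratic hL0 rfl p)
    _ = ENNReal.ofReal (6 * a + 10.72 * L * a + 350 * L ^ 2)
        + ENNReal.ofReal (6 * b + 10.72 * L * b + 0) := by
        rw [poissonPairMean_add, poissonPairMean_fst ha hb (fun i : ℕ =>
          ENNReal.ofReal (6 * ((i : ℝ) - a) ^ 2 + 10.72 * L * i + 350 * L ^ 2)),
          poissonPairMean_snd ha hb (fun i : ℕ =>
          ENNReal.ofReal (6 * ((i : ℝ) - b) ^ 2 + 10.72 * L * i + 0)),
          tsum_poissonWeight_mul_ofReal ha (fun i => by positivity)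
            (hasSum_poissonWeight_mul_quadratic ha _ _ _),
          tsum_poissonWeight_mul_ofReal hb (fun i => by positivity)
            (hasSum_poissonWeight_mul_quadratic hb _ _ _)]
    _ ≤ _ := by
        rw [← ENNReal.ofReal_add (by positivity) (by positivity)]
        apply ENNReal.ofReal_le_ofReal
        nlinarith

/-- The part of the error of the thresholded difference that occurs when it is not set to zero. -/
noncomputable def countKeptLoss (γ L d : ℝ) (p : ℕ × ℕ) : ℝ :=
  if countThreshold γ L ((p.1 : ℝ) + p.2) ≤ |(p.1 : ℝ) - p.2| then ((p.1 : ℝ) - p.2 - d) ^ 2 else 0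

lemma countKeptLoss_nonneg (γ L d : ℝ) (p : ℕ × ℕ) : 0 ≤ countKeptLoss γ L d p := by
  unfold countKeptLoss; split_ifs <;> positivity

lemma countLoss_le_add_countKeptLoss (γ L d : ℝ) (p : ℕ × ℕ) :
    countLoss γ L d p ≤ d ^ 2 + countKeptLoss γ L d p := by
  unfold countLoss countKeptLoss
  split_ifs
  · linarith [sq_nonneg d]
  · simp

lemma countKeptLoss_le_exp {γ L d m s : ℝ} (hγ : 0 ≤ γ) (hL : 0 ≤ L) (hd : |d| ≤ m) (hs : 0 ≤ s)
    (p : ℕ × ℕ) :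
    countKeptLoss γ L d p ≤ (2 * ((p.1 : ℝ) + p.2) ^ 2 + 2 * m ^ 2) *
      (Real.exp (-(s * √(2 * γ * L * ((p.1 : ℝ) + p.2)))) *
        (Real.exp (s * ((p.1 : ℝ) - p.2)) + Real.exp (-s * ((p.1 : ℝ) - p.2)))) := by
  unfold countKeptLoss
  split_ifs with h
  · have ht := (sqrt_le_countThreshold hγ hL).trans h
    set t := √(2 * γ * L * ((p.1 : ℝ) + p.2))
    set D := (p.1 : ℝ) - p.2 with hD
    have hdm : d ^ 2 ≤ m ^ 2 := sq_le_sq' (by linarith [(abs_le.1 hd).1]) (abs_le.1 hd).2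
    have h1 : (D - d) ^ 2 ≤ 2 * ((p.1 : ℝ) + p.2) ^ 2 + 2 * m ^ 2 := by
      have : (0 : ℝ) ≤ (p.1 : ℝ) * p.2 := by positivity
      nlinarith [sq_nonneg (D + d)]
    have h2 : 1 ≤ Real.exp (-(s * t)) * (Real.exp (s * D) + Real.exp (-s * D)) := by
      rw [mul_add, ← Real.exp_add, ← Real.exp_add]
      rcases le_abs.1 ht with h' | h'
      · have : 1 ≤ Real.exp (-(s * t) + s * D) := Real.one_le_exp (by nlinarith)
        linarith [Real.exp_pos (-(s * t) + -s * D)]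
      · have : 1 ≤ Real.exp (-(s * t) + -s * D) := Real.one_le_exp (by nlinarith)
        linarith [Real.exp_pos (-(s * t) + s * D)]
    calc _ ≤ (2 * ((p.1 : ℝ) + p.2) ^ 2 + 2 * m ^ 2) * 1 := by linarith
      _ ≤ _ := by gcongr
  · positivity

lemma sum_antidiagonal_countKeptLoss_le {γ L a b δ : ℝ} (hγ : 0 < γ) (hL : 0 < L) (ha : 0 ≤ a)
    (hb : 0 ≤ b) (hδ : 0 ≤ δ) (hd : |a - b| ≤ δ * (a + b)) (x : ℕ) :
    ∑ p ∈ Finset.HasAntidiagonal.antidiagonal x, poissonWeight a p.1 * poissonWeight b p.2 *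
        countKeptLoss γ L (a - b) p
      ≤ 4 * ((x : ℝ) ^ 2 + (a + b) ^ 2) * Real.exp (-(γ - 1 / 2) * L) *
        (Real.exp (-(a + b)) * ((a + b) * Real.exp (γ * δ ^ 2)) ^ x / (x.factorial : ℝ)) := by
  have hdm : |a - b| ≤ a + b := abs_le.2 ⟨by linarith, by linarith⟩
  rcases Nat.eq_zero_or_pos x with rfl | hx
  · have h0 : countKeptLoss γ L (a - b) (0, 0) = 0 := by
      have := countThreshold_pos (x := 0) hγ hL
      simp [countKeptLoss, this]
    simp [h0]
    positivity
  have hx' : (0 : ℝ) < x := by exact_mod_cast hx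
  set t := √(2 * γ * L * x) with ht
  set s := t / x with hs
  have ht0 : 0 ≤ t := Real.sqrt_nonneg _
  have hs0 : 0 ≤ s := by positivity
  have ht2 : t ^ 2 = 2 * γ * L * x := Real.sq_sqrt (by positivity)
  have hst : s * t = 2 * γ * L := by
    rw [hs, div_mul_eq_mul_div, ← pow_two, ht2]; field_simp
  have hxs : x * s = t := by rw [hs]; field_simp
  have hδt : δ * t ≤ L / 2 + γ * δ ^ 2 * x := by
    apply le_of_sq_le_sq _ (by positivity)
    nlinarith [sq_nonneg (L / 2 - γ * δ ^ 2 * x)]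
  have hexp : x * (s ^ 2 / 2 + δ * s) - s * t ≤ -(γ - 1 / 2) * L + x * (γ * δ ^ 2) := by
    have : x * (s ^ 2 / 2 + δ * s) = s * (x * s) / 2 + δ * (x * s) := by ring
    rw [this, hxs, hst]
    linarith
  calc _ ≤ ∑ p ∈ Finset.HasAntidiagonal.antidiagonal x,
        (2 * (x : ℝ) ^ 2 + 2 * (a + b) ^ 2) * Real.exp (-(s * t)) *
        (poissonWeight a p.1 * poissonWeight b p.2 *
        (Real.exp (s * ((p.1 : ℝ) - p.2)) + Real.exp (-s * ((p.1 : ℝ) - p.2)))) := by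
        refine Finset.sum_le_sum fun p hp => ?_
        have hp' : (p.1 : ℝ) + p.2 = x := by
          exact_mod_cast Finset.HasAntidiagonal.mem_antidiagonal.1 hp
        have h := countKeptLoss_le_exp hγ.le hL.le hdm hs0 p
        rw [hp'] at h
        have hw := mul_nonneg (poissonWeight_nonneg ha p.1) (poissonWeight_nonneg hb p.2)
        calc _ ≤ _ := mul_le_mul_of_nonneg_left h hw
          _ = _ := by ring
    _ ≤ (2 * (x : ℝ) ^ 2 + 2 * (a + b) ^ 2) * Real.exp (-(s * t)) *
        (2 * (Real.exp (-(a + b)) * (a + b) ^ x / (x.factorial : ℝ) *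
          Real.exp (x * (s ^ 2 / 2 + δ * s)))) := by
        rw [← Finset.mul_sum]
        have := sum_antidiagonal_exp_le ha hb hδ hd hs0 x
        gcongr
    _ = 4 * ((x : ℝ) ^ 2 + (a + b) ^ 2) *
        (Real.exp (-(a + b)) * (a + b) ^ x / (x.factorial : ℝ)) *
          Real.exp (x * (s ^ 2 / 2 + δ * s) - s * t) := by
        rw [sub_eq_add_neg, Real.exp_add]; ring
    _ ≤ 4 * ((x : ℝ) ^ 2 + (a + b) ^ 2) *
        (Real.exp (-(a + b)) * (a + b) ^ x / (x.factorial : ℝ)) *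
          Real.exp (-(γ - 1 / 2) * L + x * (γ * δ ^ 2)) := by
        gcongr
    _ = _ := by
        rw [Real.exp_add, Real.exp_nat_mul, mul_pow]; ring

lemma tsum_prod_le_of_sum_antidiagonal_le {f : ℕ × ℕ → ℝ≥0∞} {g : ℕ → ℝ≥0∞}
    (h : ∀ x, ∑ p ∈ Finset.HasAntidiagonal.antidiagonal x, f p ≤ g x) :
    ∑' p, f p ≤ ∑' x, g x := by
  rw [← Finset.HasAntidiagonal.sigmaAntidiagonalEquivProd.tsum_eq, ENNReal.tsum_sigma']
  refine ENNReal.tsum_le_tsum fun x => ?_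
  refine le_trans (le_of_eq ?_) (h x)
  rw [tsum_fintype]
  exact Finset.sum_coe_sort (Finset.HasAntidiagonal.antidiagonal x) f

lemma poissonPairMean_countKeptLoss_le {γ L a b δ c : ℝ} (hγ : 0 < γ) (hL : 0 < L) (ha : 0 ≤ a)
    (hb : 0 ≤ b) (hδ : 0 ≤ δ) (hd : |a - b| ≤ δ * (a + b)) (hδ1 : δ ^ 2 ≤ 1)
    (hδm : (a + b) * δ ^ 2 ≤ c) :
    poissonPairMean a b (fun p => ENNReal.ofReal (countKeptLoss γ L (a - b) p))
      ≤ ENNReal.ofReal (8 * Real.exp (c * γ * Real.exp γ) * Real.exp (2 * γ) *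
        Real.exp (-(γ - 1 / 2) * L) * ((a + b) + (a + b) ^ 2)) := by
  set m := a + b with hm
  have hm0 : 0 ≤ m := by positivity
  set E := Real.exp (-(γ - 1 / 2) * L) with hE
  set u := γ * δ ^ 2 with hu
  have hu0 : 0 ≤ u := by positivity
  have huγ : u ≤ γ := by nlinarith
  set m' := m * Real.exp u with hm'
  have hm'0 : 0 ≤ m' := by positivity
  have hmm' : m' ≤ m * Real.exp γ :=
    mul_le_mul_of_nonneg_left (Real.exp_le_exp.2 huγ) hm0
  have hdiff : m' - m ≤ c * γ * Real.exp γ := by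
    have h1 : Real.exp u - 1 ≤ u * Real.exp u := by
      have h := Real.add_one_le_exp (-u)
      have h' : Real.exp u * Real.exp (-u) = 1 := by rw [← Real.exp_add]; simp
      nlinarith [Real.exp_pos u]
    calc m' - m = m * (Real.exp u - 1) := by ring
      _ ≤ m * (u * Real.exp γ) := by
        have : u * Real.exp u ≤ u * Real.exp γ := by gcongr
        gcongr
        linarith
      _ = (m * δ ^ 2) * (γ * Real.exp γ) := by rw [hu]; ring
      _ ≤ c * (γ * Real.exp γ) := by gcongr
      _ = _ := by ring
  have hsum : HasSum (fun x : ℕ => 4 * ((x : ℝ) ^ 2 + m ^ 2) * E *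
      (Real.exp (-m) * m' ^ x / (x.factorial : ℝ)))
      (4 * E * Real.exp (m' - m) * (m' + m' ^ 2 + m ^ 2)) := by
    have h := ((hasSum_poissonWeight_mul_sq hm'0).add
      ((hasSum_poissonWeight hm'0).mul_right (m ^ 2))).mul_left (4 * E * Real.exp (m' - m))
    rw [one_mul] at h
    refine (congrArg (fun f : ℕ → ℝ => HasSum f _) (funext fun x => ?_)).mpr h
    unfold poissonWeight
    have e : Real.exp (-m) = Real.exp (m' - m) * Real.exp (-m') := by
      rw [← Real.exp_add]; ring_nf
    rw [e]
    ring
  have hle : poissonPairMean a b (fun p => ENNReal.ofReal (countKeptLoss γ L (a - b) p))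
      ≤ ∑' x : ℕ, ENNReal.ofReal (4 * ((x : ℝ) ^ 2 + m ^ 2) * E *
      (Real.exp (-m) * m' ^ x / (x.factorial : ℝ))) := by
    refine tsum_prod_le_of_sum_antidiagonal_le fun x => ?_
    have hw : ∀ p : ℕ × ℕ, 0 ≤ poissonWeight a p.1 * poissonWeight b p.2 := fun p =>
      mul_nonneg (poissonWeight_nonneg ha p.1) (poissonWeight_nonneg hb p.2)
    simp_rw [← ENNReal.ofReal_mul (hw _)]
    rw [← ENNReal.ofReal_sum_of_nonneg
      (fun p _ => mul_nonneg (hw p) (countKeptLoss_nonneg _ _ _ _))]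
    exact ENNReal.ofReal_le_ofReal (sum_antidiagonal_countKeptLoss_le hγ hL ha hb hδ hd x)
  refine hle.trans ?_
  rw [← ENNReal.ofReal_tsum_of_nonneg (fun x => by positivity) hsum.summable, hsum.tsum_eq]
  apply ENNReal.ofReal_le_ofReal
  have h1 : (1 : ℝ) ≤ Real.exp γ := Real.one_le_exp hγ.le
  have h2 : Real.exp (2 * γ) = Real.exp γ ^ 2 := by rw [← Real.exp_nat_mul]; norm_num
  have h3 : m' + m' ^ 2 + m ^ 2 ≤ Real.exp (2 * γ) * (2 * (m + m ^ 2)) := by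
    have e1 : m' ≤ m * Real.exp γ ^ 2 := hmm'.trans (by gcongr; nlinarith)
    have e2 : m' ^ 2 ≤ (m * Real.exp γ) ^ 2 := by gcongr
    have e3 : m ^ 2 ≤ m ^ 2 * Real.exp γ ^ 2 := by
      have : 1 ≤ Real.exp γ ^ 2 := by nlinarith
      nlinarith [sq_nonneg m]
    have e4 : 0 ≤ m * Real.exp γ ^ 2 := by positivity
    rw [h2]
    nlinarith
  calc 4 * E * Real.exp (m' - m) * (m' + m' ^ 2 + m ^ 2)
      ≤ 4 * E * Real.exp (c * γ * Real.exp γ) * (Real.exp (2 * γ) * (2 * (m + m ^ 2))) := by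
        gcongr
    _ = _ := by ring

theorem exists_poissonPairMean_countLoss_le :
    ∃ C : ℝ, 0 ≤ C ∧ ∀ L a b : ℝ, 10 ≤ L → 0 ≤ a → 0 ≤ b → (a - b ≠ 0 → 1000 * L ≤ a + b) →
      poissonPairMean a b (fun p => ENNReal.ofReal (countLoss (1 + √2) L (a - b) p)) ≤
        ENNReal.ofReal (12 * L * min ((a - b) ^ 2) (a + b)
          + C * Real.exp (-(3 / 2) * L) * ((a + b) + (a + b) ^ 2)) := by
  set γ := 1 + √2 with hγ
  have hγ2 : 2 ≤ γ := by
    have : (1 : ℝ) ≤ √2 := Real.one_le_sqrt.2 (by norm_num)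
    linarith
  refine ⟨8 * Real.exp (1 * γ * Real.exp γ) * Real.exp (2 * γ), by positivity, ?_⟩
  intro L a b hL ha hb hlarge
  have hL0 : 0 < L := by linarith
  by_cases hcase : a - b ≠ 0 ∧ a + b ≤ (a - b) ^ 2
  · rw [min_eq_right hcase.2]
    refine (poissonPairMean_countLoss_le_of_large hL ha hb (hlarge hcase.1)).trans ?_
    apply ENNReal.ofReal_le_ofReal
    have : 0 ≤ 8 * Real.exp (1 * γ * Real.exp γ) * Real.exp (2 * γ) *
      Real.exp (-(3 / 2) * L) * ((a + b) + (a + b) ^ 2) := by positivity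
    linarith
  · have hmin : min ((a - b) ^ 2) (a + b) = (a - b) ^ 2 := by
      apply min_eq_left
      by_contra! h
      refine hcase ⟨fun h0 => ?_, h.le⟩
      rw [h0] at h
      nlinarith
    have hdm : (a - b) ^ 2 ≤ a + b := min_eq_left_iff.1 hmin
    rw [hmin]
    have hδ : ∃ δ : ℝ, 0 ≤ δ ∧ |a - b| ≤ δ * (a + b) ∧ δ ^ 2 ≤ 1 ∧ (a + b) * δ ^ 2 ≤ 1 := by
      by_cases h0 : a - b = 0
      · exact ⟨0, by simp [h0]⟩
      · have hm : 1 ≤ a + b := by linarith [hlarge h0]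
        have hm0 : 0 < a + b := by linarith
        have h1 : (a + b) * (|a - b| / (a + b)) ^ 2 ≤ 1 := by
          rw [div_pow, sq_abs, ← mul_div_assoc, div_le_one (by positivity)]
          nlinarith
        refine ⟨|a - b| / (a + b), by positivity, ?_, ?_, h1⟩
        · rw [div_mul_cancel₀ _ hm0.ne']
        · nlinarith [sq_nonneg (|a - b| / (a + b))]
    obtain ⟨δ, hδ0, hδd, hδ1, hδm⟩ := hδ
    calc _ ≤ poissonPairMean a b (fun p => ENNReal.ofReal ((a - b) ^ 2)
          + ENNReal.ofReal (countKeptLoss γ L (a - b) p)) := by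
          refine poissonPairMean_mono fun p => ?_
          rw [← ENNReal.ofReal_add (by positivity) (countKeptLoss_nonneg _ _ _ _)]
          exact ENNReal.ofReal_le_ofReal (countLoss_le_add_countKeptLoss _ _ _ _)
      _ ≤ ENNReal.ofReal ((a - b) ^ 2) + ENNReal.ofReal (8 * Real.exp (1 * γ * Real.exp γ) *
          Real.exp (2 * γ) * Real.exp (-(γ - 1 / 2) * L) * ((a + b) + (a + b) ^ 2)) := by
          rw [poissonPairMean_add, poissonPairMean_const ha hb]
          gcongr
          exact poissonPairMean_countKeptLoss_le (by linarith) hL0 ha hb hδ0 hδd hδ1 hδm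
      _ ≤ _ := by
          rw [← ENNReal.ofReal_add (by positivity) (by positivity)]
          apply ENNReal.ofReal_le_ofReal
          have h1 : (a - b) ^ 2 ≤ 12 * L * (a - b) ^ 2 := by nlinarith [sq_nonneg (a - b)]
          have h2 : -(γ - 1 / 2) * L ≤ -(3 / 2) * L := by nlinarith
          gcongr

/-! ### The structure of the Haar functions -/

/-- The dyadic level of a Haar function: its support has length `2^{-level}`. -/
def haarLevel (l : HaarIndex) : ℕ := l.scale.toNat

/-- The left endpoint of the support. -/
noncomputable def haarLeft (l : HaarIndex) : ℝ := l.shift / 2 ^ haarLevel l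

/-- The right endpoint of the support. -/
noncomputable def haarRight (l : HaarIndex) : ℝ := (l.shift + 1) / 2 ^ haarLevel l

/-- The end of the interval where the Haar function is positive. -/
noncomputable def haarMid (l : HaarIndex) : ℝ :=
  (l.shift + if l.scale = -1 then 1 else 1 / 2) / 2 ^ haarLevel l

/-- The sup-norm `2^{level/2}`. -/
noncomputable def haarAmp (l : HaarIndex) : ℝ := √(2 ^ haarLevel l)

lemma haarAmp_pos (l : HaarIndex) : 0 < haarAmp l := by unfold haarAmp; positivity

lemma haarAmp_sq (l : HaarIndex) : haarAmp l ^ 2 = 2 ^ haarLevel l := Real.sq_sqrt (by positivity)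

lemma haarLeft_lt_haarMid (l : HaarIndex) : haarLeft l < haarMid l := by
  unfold haarLeft haarMid
  gcongr
  split_ifs <;> norm_num

lemma haarMid_le_haarRight (l : HaarIndex) : haarMid l ≤ haarRight l := by
  unfold haarRight haarMid
  gcongr
  split_ifs <;> norm_num

lemma haarLeft_lt_haarRight (l : HaarIndex) : haarLeft l < haarRight l :=
  (haarLeft_lt_haarMid l).trans_le (haarMid_le_haarRight l)

lemma haarRight_sub_haarLeft (l : HaarIndex) :
    haarRight l - haarLeft l = (2 ^ haarLevel l)⁻¹ := by
  unfold haarRight haarLeft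
  field_simp
  ring

/-- The set where the Haar function is positive. -/
def haarPos (l : HaarIndex) : Set ℝ := Set.Icc (haarLeft l) (haarMid l)

/-- The set where the Haar function is negative. -/
def haarNeg (l : HaarIndex) : Set ℝ := Set.Ioc (haarMid l) (haarRight l)

lemma measurableSet_haarPos (l : HaarIndex) : MeasurableSet (haarPos l) := measurableSet_Icc

lemma measurableSet_haarNeg (l : HaarIndex) : MeasurableSet (haarNeg l) := measurableSet_Ioc

lemma disjoint_haarPos_haarNeg (l : HaarIndex) : Disjoint (haarPos l) (haarNeg l) :=
  Set.disjoint_left.2 fun _ h h' => not_lt.2 h.2 h'.1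

lemma haarPos_union_haarNeg (l : HaarIndex) :
    haarPos l ∪ haarNeg l = Set.Icc (haarLeft l) (haarRight l) :=
  Set.Icc_union_Ioc_eq_Icc (haarLeft_lt_haarMid l).le (haarMid_le_haarRight l)

lemma scale_of_ne {l : HaarIndex} (h : l.scale ≠ -1) : l.scale = (haarLevel l : ℤ) := by
  have := l.2
  unfold haarLevel HaarIndex.scale at *
  omega

lemma haarLevel_of_eq {l : HaarIndex} (h : l.scale = -1) : haarLevel l = 0 := by
  unfold haarLevel; omega

lemma haarMid_of_scale_ne {l : HaarIndex} (h : l.scale ≠ -1) :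
    haarMid l = (l.shift + 1 / 2) / 2 ^ haarLevel l := by
  rw [haarMid, if_neg h]

lemma haar_eq (l : HaarIndex) (x : ℝ) :
    haar l x = haarAmp l * ((haarPos l).indicator 1 x - (haarNeg l).indicator 1 x) := by
  unfold haar haarPos haarNeg haarAmp haarMid haarLeft haarRight
  split_ifs with h
  · rw [haarLevel_of_eq h]
    have : (x - (l.shift : ℝ) ∈ Set.Icc (0 : ℝ) 1) ↔
        x ∈ Set.Icc (l.shift : ℝ) (l.shift + 1) := by
      simp only [Set.mem_Icc]
      constructor <;> rintro ⟨h1, h2⟩ <;> constructor <;> linarith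
    simp [haarFather, Set.indicator, -Set.mem_Icc, this]
  · have hp : (0 : ℝ) < 2 ^ haarLevel l := by positivity
    have e1 : (2 : ℝ) ^ ((l.scale : ℝ) / 2) = √(2 ^ haarLevel l) := by
      rw [scale_of_ne h, Real.sqrt_eq_rpow, ← Real.rpow_natCast, ← Real.rpow_mul (by norm_num)]
      push_cast
      ring_nf
    have e2 : (2 : ℝ) ^ l.scale = 2 ^ haarLevel l := by rw [scale_of_ne h, zpow_natCast]
    rw [e1, e2]
    have h1 : (2 ^ haarLevel l * x - (l.shift : ℝ) ∈ Set.Icc (0 : ℝ) (1 / 2)) ↔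
        x ∈ Set.Icc ((l.shift : ℝ) / 2 ^ haarLevel l) ((l.shift + 1 / 2) / 2 ^ haarLevel l) := by
      rw [Set.mem_Icc, Set.mem_Icc, div_le_iff₀ hp, le_div_iff₀ hp]
      constructor <;> rintro ⟨h1, h2⟩ <;> constructor <;> linarith
    have h2 : (2 ^ haarLevel l * x - (l.shift : ℝ) ∈ Set.Ioc (1 / 2 : ℝ) 1) ↔
        x ∈ Set.Ioc ((l.shift + 1 / 2 : ℝ) / 2 ^ haarLevel l)
          ((l.shift + 1) / 2 ^ haarLevel l) := by
      rw [Set.mem_Ioc, Set.mem_Ioc, div_lt_iff₀ hp, le_div_iff₀ hp]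
      constructor <;> rintro ⟨h1, h2⟩ <;> constructor <;> linarith
    simp only [haarMother, Set.indicator, h1, h2, Pi.one_apply]

lemma haar_of_mem_haarPos {l : HaarIndex} {x : ℝ} (h : x ∈ haarPos l) : haar l x = haarAmp l := by
  have h' : x ∉ haarNeg l := Set.disjoint_left.1 (disjoint_haarPos_haarNeg l) h
  simp [haar_eq, h, h']

lemma haar_of_mem_haarNeg {l : HaarIndex} {x : ℝ} (h : x ∈ haarNeg l) :
    haar l x = -haarAmp l := by
  have h' : x ∉ haarPos l := Set.disjoint_right.1 (disjoint_haarPos_haarNeg l) h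
  simp [haar_eq, h, h']

lemma haar_of_notMem {l : HaarIndex} {x : ℝ} (h : x ∉ Set.Icc (haarLeft l) (haarRight l)) :
    haar l x = 0 := by
  rw [← haarPos_union_haarNeg, Set.mem_union, not_or] at h
  simp [haar_eq, h.1, h.2]

lemma haar_sq_eq (l : HaarIndex) (x : ℝ) :
    haar l x ^ 2 = 2 ^ haarLevel l * (Set.Icc (haarLeft l) (haarRight l)).indicator 1 x := by
  by_cases h : x ∈ Set.Icc (haarLeft l) (haarRight l)
  · rw [Set.indicator_of_mem h]
    rw [← haarPos_union_haarNeg] at h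
    rcases h with h | h
    · simp [haar_of_mem_haarPos h, haarAmp_sq]
    · simp [haar_of_mem_haarNeg h, haarAmp_sq]
  · simp [haar_of_notMem h, h]

lemma support_haar (l : HaarIndex) :
    Function.support (haar l) = Set.Icc (haarLeft l) (haarRight l) := by
  ext x
  rw [Function.mem_support, ne_eq, ← sq_eq_zero_iff, haar_sq_eq]
  by_cases h : x ∈ Set.Icc (haarLeft l) (haarRight l) <;> simp [h]

lemma measurable_haar (l : HaarIndex) : Measurable (haar l) := by
  have : haar l = fun x => haarAmp l *
      ((haarPos l).indicator 1 x - (haarNeg l).indicator 1 x) := funext (haar_eq l)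
  rw [this]
  exact ((measurable_one.indicator (measurableSet_haarPos l)).sub
    (measurable_one.indicator (measurableSet_haarNeg l))).const_mul _

lemma abs_haar_eq (l : HaarIndex) (x : ℝ) :
    |haar l x| = (Set.Icc (haarLeft l) (haarRight l)).indicator (fun _ => haarAmp l) x := by
  rw [← Real.sqrt_sq_eq_abs, haar_sq_eq]
  by_cases h : x ∈ Set.Icc (haarLeft l) (haarRight l) <;> simp [h, haarAmp]

lemma abs_haar_le (l : HaarIndex) (x : ℝ) : |haar l x| ≤ haarAmp l := by
  rw [abs_haar_eq]
  exact Set.indicator_apply_le' (fun _ => le_rfl) (fun _ => (haarAmp_pos l).le)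

lemma integrable_haar (l : HaarIndex) : Integrable (haar l) := by
  refine Integrable.mono' (g := (Set.Icc (haarLeft l) (haarRight l)).indicator fun _ => haarAmp l)
    ?_ (measurable_haar l).aestronglyMeasurable (Eventually.of_forall fun x => ?_)
  · exact (integrable_indicator_iff measurableSet_Icc).2 (integrableOn_const (by simp))
  · rw [Real.norm_eq_abs, abs_haar_eq]

lemma integrable_haar_mul {g : ℝ → ℝ} (hg : Integrable g) (l : HaarIndex) :
    Integrable (fun x => haar l x * g x) :=
  hg.bdd_mul (c := haarAmp l) (measurable_haar l).aestronglyMeasurable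
    (Eventually.of_forall fun x => by simpa using abs_haar_le l x)

lemma haarSupNorm_eq (l : HaarIndex) : haarSupNorm l = haarAmp l := by
  have h : eLpNorm (haar l) ∞ volume =
      eLpNorm ((Set.Icc (haarLeft l) (haarRight l)).indicator fun _ => haarAmp l) ∞ volume := by
    refine eLpNorm_congr_norm_ae (Eventually.of_forall fun x => ?_)
    rw [Real.norm_eq_abs, abs_haar_eq, Real.norm_eq_abs, abs_of_nonneg]
    exact Set.indicator_nonneg (fun _ _ => (haarAmp_pos l).le) x
  rw [haarSupNorm, h, eLpNorm_exponent_top, eLpNormEssSup_indicator_const_eq]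
  · simp [(haarAmp_pos l).le]
  · simp [haarLeft_lt_haarRight l]

lemma integral_haar_mul_eq {g : ℝ → ℝ} (hg : Integrable g) (l : HaarIndex) :
    ∫ x, haar l x * g x =
      haarAmp l * ((∫ x in haarPos l, g x) - ∫ x in haarNeg l, g x) := by
  rw [← integral_indicator (measurableSet_haarPos l), ← integral_indicator (measurableSet_haarNeg l),
    ← integral_sub (hg.indicator (measurableSet_haarPos l))
      (hg.indicator (measurableSet_haarNeg l)), ← integral_const_mul]
  refine integral_congr_ae (Eventually.of_forall fun x => ?_)
  simp only [haar_eq, Set.indicator]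
  split_ifs <;> simp

lemma integral_haar_sq_mul_eq (g : ℝ → ℝ) (l : HaarIndex) :
    ∫ x, haar l x ^ 2 * g x = 2 ^ haarLevel l * haarMass g l := by
  rw [haarMass, support_haar, ← integral_indicator measurableSet_Icc, ← integral_const_mul]
  refine integral_congr_ae (Eventually.of_forall fun x => ?_)
  simp only [haar_sq_eq, Set.indicator]
  split_ifs <;> simp

lemma haarMass_eq_add {g : ℝ → ℝ} (hg : Integrable g) (l : HaarIndex) :
    haarMass g l = (∫ x in haarPos l, g x) + ∫ x in haarNeg l, g x := by
  rw [haarMass, support_haar, ← haarPos_union_haarNeg,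
    setIntegral_union (disjoint_haarPos_haarNeg l) (measurableSet_haarNeg l) hg.integrableOn
      hg.integrableOn]

/-! ### Orthonormality -/

lemma integral_haar_mul_self (l : HaarIndex) : ∫ x, haar l x * haar l x = 1 := by
  have h := integral_haar_sq_mul_eq (fun _ => 1) l
  simp only [mul_one, haarMass, support_haar, setIntegral_const, smul_eq_mul,
    Real.volume_real_Icc_of_le (haarLeft_lt_haarRight l).le, haarRight_sub_haarLeft, pow_two] at h
  rw [h]
  exact mul_inv_cancel₀ (by positivity)

lemma integral_haar_of_scale_ne {l : HaarIndex} (h : l.scale ≠ -1) : ∫ x, haar l x = 0 := by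
  have h1 : haar l = fun x => haarAmp l *
      ((haarPos l).indicator 1 x - (haarNeg l).indicator 1 x) := funext (haar_eq l)
  rw [h1, integral_const_mul, integral_sub, integral_indicator_one (measurableSet_haarPos l),
    integral_indicator_one (measurableSet_haarNeg l), haarPos, haarNeg,
    Real.volume_real_Icc_of_le (haarLeft_lt_haarMid l).le,
    Real.volume_real_Ioc_of_le (haarMid_le_haarRight l)]
  · simp only [haarLeft, haarMid, haarRight, if_neg h]
    ring
  · exact (integrable_indicator_iff (measurableSet_haarPos l)).2
      (integrableOn_const (by simp [haarPos]))
  · exact (integrable_indicator_iff (measurableSet_haarNeg l)).2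
      (integrableOn_const (by simp [haarNeg]))

lemma intCast_div_le_iff {j : ℕ} {k : ℤ} {x : ℝ}
    (hx : x ∈ Set.Ioo ((k : ℝ) / 2 ^ j) ((k + 1) / 2 ^ j)) (p : ℤ) :
    (p : ℝ) / 2 ^ j ≤ x ↔ p ≤ k := by
  constructor
  · intro h
    have := h.trans_lt hx.2
    rw [div_lt_div_iff_of_pos_right (by positivity)] at this
    have h' : p < k + 1 := by exact_mod_cast this
    omega
  · intro h
    refine le_trans ?_ hx.1.le
    have : (p : ℝ) ≤ k := by exact_mod_cast h
    gcongr

lemma le_intCast_div_iff {j : ℕ} {k : ℤ} {x : ℝ}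
    (hx : x ∈ Set.Ioo ((k : ℝ) / 2 ^ j) ((k + 1) / 2 ^ j)) (p : ℤ) :
    x ≤ (p : ℝ) / 2 ^ j ↔ k < p := by
  constructor
  · intro h
    have := hx.1.trans_le h
    rw [div_lt_div_iff_of_pos_right (by positivity)] at this
    exact_mod_cast this
  · intro h
    refine hx.2.le.trans ?_
    have : ((k + 1 : ℤ) : ℝ) ≤ p := by exact_mod_cast h
    push_cast at this
    gcongr

lemma ae_mem_Ioo_of_mem_Icc (a b : ℝ) :
    ∀ᵐ x : ℝ, x ∈ Set.Icc a b → x ∈ Set.Ioo a b := by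
  have : ∀ c : ℝ, ∀ᵐ x : ℝ, x ≠ c := fun c => by simp [ae_iff]
  filter_upwards [this a, this b] with x h1 h2 h
  exact ⟨lt_of_le_of_ne h.1 h1.symm, lt_of_le_of_ne h.2 h2⟩

/-- A Haar function is constant on the dyadic intervals that are finer than its pieces. -/
lemma haar_eq_of_mem_Ioo {l : HaarIndex} {j : ℕ} {k p q r : ℤ}
    (hp : haarLeft l = p / 2 ^ j) (hq : haarMid l = q / 2 ^ j) (hr : haarRight l = r / 2 ^ j)
    {x y : ℝ} (hx : x ∈ Set.Ioo ((k : ℝ) / 2 ^ j) ((k + 1) / 2 ^ j))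
    (hy : y ∈ Set.Ioo ((k : ℝ) / 2 ^ j) ((k + 1) / 2 ^ j)) : haar l x = haar l y := by
  have h1 : x ∈ haarPos l ↔ y ∈ haarPos l := by
    rw [haarPos, hp, hq, Set.mem_Icc, Set.mem_Icc, intCast_div_le_iff hx, intCast_div_le_iff hy,
      le_intCast_div_iff hx, le_intCast_div_iff hy]
  have h2 : x ∈ haarNeg l ↔ y ∈ haarNeg l := by
    rw [haarNeg, hq, hr, Set.mem_Ioc, Set.mem_Ioc, ← not_le, ← not_le, le_intCast_div_iff hx,
      le_intCast_div_iff hy, le_intCast_div_iff hx, le_intCast_div_iff hy]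
  have h3 := Set.indicator_eq_indicator (f := (1 : ℝ → ℝ)) (g := 1) h1 rfl
  have h4 := Set.indicator_eq_indicator (f := (1 : ℝ → ℝ)) (g := 1) h2 rfl
  rw [haar_eq, haar_eq, h3, h4]

lemma exists_endpoints_eq {l : HaarIndex} {l' : HaarIndex} (h : l.scale < l'.scale) :
    ∃ p q r : ℤ, haarLeft l = p / 2 ^ haarLevel l' ∧ haarMid l = q / 2 ^ haarLevel l' ∧
      haarRight l = r / 2 ^ haarLevel l' := by
  have hl' : l'.scale ≠ -1 := by have := l.2; unfold HaarIndex.scale at *; omega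
  have e' := scale_of_ne hl'
  by_cases h1 : l.scale = -1
  · refine ⟨l.shift * 2 ^ haarLevel l', (l.shift + 1) * 2 ^ haarLevel l',
      (l.shift + 1) * 2 ^ haarLevel l', ?_, ?_, ?_⟩ <;>
    simp [haarLeft, haarMid, haarRight, haarLevel_of_eq h1, h1]
  · have e := scale_of_ne h1
    obtain ⟨d, hd⟩ : ∃ d : ℕ, haarLevel l' = haarLevel l + (d + 1) :=
      ⟨haarLevel l' - haarLevel l - 1, by omega⟩
    refine ⟨l.shift * 2 ^ (d + 1), (2 * l.shift + 1) * 2 ^ d, (l.shift + 1) * 2 ^ (d + 1),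
      ?_, ?_, ?_⟩ <;>
    · simp only [haarLeft, haarMid, haarRight, if_neg h1, hd]
      push_cast
      field_simp
      try ring

lemma integral_haar_mul_haar_of_scale_lt {l l' : HaarIndex} (h : l.scale < l'.scale) :
    ∫ x, haar l x * haar l' x = 0 := by
  have hl' : l'.scale ≠ -1 := by have := l.2; unfold HaarIndex.scale at *; omega
  obtain ⟨p, q, r, hp, hq, hr⟩ := exists_endpoints_eq h
  have hy : (haarLeft l' + haarRight l') / 2 ∈ Set.Ioo (haarLeft l') (haarRight l') := by
    have := haarLeft_lt_haarRight l'
    constructor <;> linarith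
  have hae : (fun x => haar l x * haar l' x) =ᵐ[volume]
      fun x => haar l ((haarLeft l' + haarRight l') / 2) * haar l' x := by
    filter_upwards [ae_mem_Ioo_of_mem_Icc (haarLeft l') (haarRight l')] with x hx
    by_cases hm : x ∈ Set.Icc (haarLeft l') (haarRight l')
    · rw [haar_eq_of_mem_Ioo hp hq hr (hx hm) hy]
    · simp [haar_of_notMem hm]
  rw [integral_congr_ae hae, integral_const_mul, integral_haar_of_scale_ne hl', mul_zero]

lemma integral_haar_mul_haar_of_scale_eq {l l' : HaarIndex} (h : l.scale = l'.scale)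
    (hne : l ≠ l') : ∫ x, haar l x * haar l' x = 0 := by
  have hlev : haarLevel l = haarLevel l' := by unfold haarLevel; rw [h]
  have hs : l.shift ≠ l'.shift := fun hs => hne (Subtype.ext (Prod.ext h hs))
  rw [← integral_zero ℝ ℝ]
  refine integral_congr_ae ?_
  filter_upwards [ae_mem_Ioo_of_mem_Icc (haarLeft l') (haarRight l')] with x hx
  by_cases hm' : x ∈ Set.Icc (haarLeft l') (haarRight l')
  · have hx' := hx hm'
    have hm : x ∉ Set.Icc (haarLeft l) (haarRight l) := by
      rintro ⟨h1, h2⟩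
      unfold haarLeft haarRight at *
      rw [hlev] at h1 h2
      have h3 := (intCast_div_le_iff hx' _).1 h1
      have h4 := (le_intCast_div_iff hx' (l.shift + 1)).1 (by exact_mod_cast h2)
      omega
    simp [haar_of_notMem hm]
  · simp [haar_of_notMem hm']

open Classical in
theorem integral_haar_mul_haar (l l' : HaarIndex) :
    ∫ x, haar l x * haar l' x = if l = l' then 1 else 0 := by
  split_ifs with h
  · rw [h, integral_haar_mul_self]
  · rcases lt_trichotomy l.scale l'.scale with h1 | h1 | h1
    · exact integral_haar_mul_haar_of_scale_lt h1
    · exact integral_haar_mul_haar_of_scale_eq h1 h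
    · simp_rw [mul_comm (haar l _)]
      exact integral_haar_mul_haar_of_scale_lt h1

/-! ### Completeness -/

lemma setIntegral_haarPos (g : ℝ → ℝ) (l : HaarIndex) :
    ∫ x in haarPos l, g x = ∫ x in (haarLeft l)..(haarMid l), g x := by
  rw [haarPos, integral_Icc_eq_integral_Ioc,
    intervalIntegral.integral_of_le (haarLeft_lt_haarMid l).le]

lemma setIntegral_haarNeg (g : ℝ → ℝ) (l : HaarIndex) :
    ∫ x in haarNeg l, g x = ∫ x in (haarMid l)..(haarRight l), g x := by
  rw [haarNeg, intervalIntegral.integral_of_le (haarMid_le_haarRight l)]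

lemma intervalIntegral_eq_of_haarCoeff_eq_zero {g : ℝ → ℝ} (hg : Integrable g) {l : HaarIndex}
    (h : haarCoeff g l = 0) :
    ∫ x in (haarLeft l)..(haarMid l), g x = ∫ x in (haarMid l)..(haarRight l), g x := by
  rw [haarCoeff, integral_haar_mul_eq hg, setIntegral_haarPos, setIntegral_haarNeg] at h
  have := (mul_eq_zero.1 h).resolve_left (haarAmp_pos l).ne'
  linarith

lemma dyadic_intervalIntegral_eq_zero {g : ℝ → ℝ} (hg : Integrable g)
    (h : ∀ l, haarCoeff g l = 0) (j : ℕ) :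
    ∀ k : ℤ, ∫ x in ((k : ℝ) / 2 ^ j)..((k + 1) / 2 ^ j), g x = 0 := by
  induction j with
  | zero =>
    intro k
    have := intervalIntegral_eq_of_haarCoeff_eq_zero hg (h ⟨(-1, k), le_rfl⟩)
    simpa [haarLeft, haarMid, haarRight, haarLevel, HaarIndex.scale, HaarIndex.shift] using this
  | succ j ih =>
    have key : ∀ k : ℤ,
        ∫ x in (((2 * k : ℤ) : ℝ) / 2 ^ (j + 1))..(((2 * k + 1 : ℤ) : ℝ) / 2 ^ (j + 1)), g x = 0 ∧
        ∫ x in (((2 * k + 1 : ℤ) : ℝ) / 2 ^ (j + 1))..(((2 * k + 2 : ℤ) : ℝ) / 2 ^ (j + 1)),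
          g x = 0 := by
      intro k
      have h1 := intervalIntegral_eq_of_haarCoeff_eq_zero hg
        (h ⟨((j : ℤ), k), show (-1 : ℤ) ≤ j by omega⟩)
      have hj : HaarIndex.scale ⟨((j : ℤ), k), show (-1 : ℤ) ≤ j by omega⟩ ≠ -1 := by
        simp only [HaarIndex.scale]
        omega
      rw [haarMid_of_scale_ne hj] at h1
      simp only [haarLeft, haarRight, haarLevel, HaarIndex.scale, HaarIndex.shift,
        Int.toNat_natCast] at h1
      have h2 := ih k
      rw [← intervalIntegral.integral_add_adjacent_intervals (b := ((k : ℝ) + 1 / 2) / 2 ^ j)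
        hg.intervalIntegrable hg.intervalIntegrable] at h2
      have e1 : ((2 * k : ℤ) : ℝ) / 2 ^ (j + 1) = (k : ℝ) / 2 ^ j := by
        push_cast; field_simp; ring
      have e2 : ((2 * k + 1 : ℤ) : ℝ) / 2 ^ (j + 1) = ((k : ℝ) + 1 / 2) / 2 ^ j := by
        push_cast; field_simp; ring
      have e3 : ((2 * k + 2 : ℤ) : ℝ) / 2 ^ (j + 1) = ((k : ℝ) + 1) / 2 ^ j := by
        push_cast; field_simp; ring
      rw [e1, e2, e3]
      constructor <;> linarith
    intro k
    obtain ⟨i, rfl | rfl⟩ := Int.even_or_odd' k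
    · exact_mod_cast (key i).1
    · have := (key i).2
      have e : ((2 * i + 2 : ℤ) : ℝ) = ((2 * i + 1 : ℤ) : ℝ) + 1 := by push_cast; ring
      rwa [e] at this

lemma dyadic_primitive_eq_zero {g : ℝ → ℝ} (hg : Integrable g)
    (h : ∀ l, haarCoeff g l = 0) (j : ℕ) (k : ℤ) :
    ∫ x in (0 : ℝ)..((k : ℝ) / 2 ^ j), g x = 0 := by
  have step : ∀ i : ℤ, ∫ x in (0 : ℝ)..(((i + 1 : ℤ) : ℝ) / 2 ^ j), g x
      = ∫ x in (0 : ℝ)..((i : ℝ) / 2 ^ j), g x := by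
    intro i
    rw [← intervalIntegral.integral_add_adjacent_intervals (b := (i : ℝ) / 2 ^ j)
        hg.intervalIntegrable hg.intervalIntegrable]
    push_cast
    rw [dyadic_intervalIntegral_eq_zero hg h, add_zero]
  induction k using Int.induction_on with
  | zero => simp
  | succ i ih => rw [step]; exact_mod_cast ih
  | pred i ih =>
    rw [← step, sub_add_cancel]
    exact_mod_cast ih

lemma tendsto_floor_dyadic (x : ℝ) :
    Tendsto (fun j : ℕ => ((⌊(2 : ℝ) ^ j * x⌋ : ℤ) : ℝ) / 2 ^ j) atTop (nhds x) := by
  have h0 : Tendsto (fun j : ℕ => x - (1 / 2 : ℝ) ^ j) atTop (nhds x) := by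
    simpa using tendsto_const_nhds.sub
      (tendsto_pow_atTop_nhds_zero_of_lt_one (r := (1 / 2 : ℝ)) (by norm_num) (by norm_num))
  refine tendsto_of_tendsto_of_tendsto_of_le_of_le h0 tendsto_const_nhds ?_ ?_
  · intro j
    have := Int.lt_floor_add_one ((2 : ℝ) ^ j * x)
    have hp : (0 : ℝ) < 2 ^ j := by positivity
    rw [le_div_iff₀ hp, sub_mul, ← mul_pow]
    norm_num
    linarith
  · intro j
    have := Int.floor_le ((2 : ℝ) ^ j * x)
    have hp : (0 : ℝ) < 2 ^ j := by positivity
    rw [div_le_iff₀ hp]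
    linarith

theorem ae_eq_zero_of_haarCoeff_eq_zero {g : ℝ → ℝ} (hg : Integrable g)
    (h : ∀ l, haarCoeff g l = 0) : g =ᵐ[volume] 0 := by
  have hG : ∀ x, ∫ t in (0 : ℝ)..x, g t = 0 := by
    intro x
    have hc : Continuous fun y => ∫ t in (0 : ℝ)..y, g t :=
      intervalIntegral.continuous_primitive (fun a b => hg.intervalIntegrable) 0
    refine tendsto_nhds_unique ((hc.tendsto x).comp (tendsto_floor_dyadic x)) ?_
    refine tendsto_const_nhds.congr fun j => ?_
    exact (dyadic_primitive_eq_zero hg h j _).symm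
  filter_upwards [LocallyIntegrable.ae_hasDerivAt_integral hg.locallyIntegrable] with x hx
  have h1 := hx 0
  simp only [hG] at h1
  exact h1.unique (hasDerivAt_const x (0 : ℝ))

/-! ### Finite Haar expansions -/

lemma haarCoeff_sub_sum {f : ℝ → ℝ} (hf : Integrable f) (T : Finset HaarIndex)
    (c : HaarIndex → ℝ) (l : HaarIndex) [Decidable (l ∈ T)] :
    haarCoeff (fun x => f x - ∑ i ∈ T, c i * haar i x) l
      = haarCoeff f l - if l ∈ T then c l else 0 := by
  classical
  have hi : ∀ i ∈ T, Integrable fun x => haar l x * (c i * haar i x) := fun i _ =>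
    integrable_haar_mul ((integrable_haar i).const_mul (c i)) l
  simp only [haarCoeff, mul_sub, Finset.mul_sum]
  rw [integral_sub (integrable_haar_mul hf l) (integrable_finsetSum T hi), integral_finsetSum T hi]
  simp_rw [mul_left_comm (haar l _), integral_const_mul, integral_haar_mul_haar]
  simp

theorem ae_eq_sum_haar {f : ℝ → ℝ} (hf : Integrable f) {T : Finset HaarIndex}
    (hT : ∀ l, l ∉ T → haarCoeff f l = 0) :
    f =ᵐ[volume] fun x => ∑ i ∈ T, haarCoeff f i * haar i x := by
  classical
  have hg : Integrable (fun x => f x - ∑ i ∈ T, haarCoeff f i * haar i x) :=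
    hf.sub (integrable_finsetSum T fun i _ => (integrable_haar i).const_mul _)
  have h := ae_eq_zero_of_haarCoeff_eq_zero hg fun l => by
    rw [haarCoeff_sub_sum hf]
    split_ifs with hl
    · ring
    · rw [hT l hl, sub_zero]
  filter_upwards [h] with x hx
  exact sub_eq_zero.1 hx

theorem eLpNorm_sum_haar_sq (T : Finset HaarIndex) (c : HaarIndex → ℝ) :
    eLpNorm (fun x => ∑ i ∈ T, c i * haar i x) 2 volume ^ 2
      = ∑ i ∈ T, ENNReal.ofReal (c i ^ 2) := by
  classical
  have h1 : eLpNorm (fun x => ∑ i ∈ T, c i * haar i x) 2 volume ^ 2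
      = ∫⁻ x, ENNReal.ofReal ((∑ i ∈ T, c i * haar i x) ^ 2) := by
    have := eLpNorm_nnreal_pow_eq_lintegral (f := fun x => ∑ i ∈ T, c i * haar i x)
      (μ := volume) (p := 2) (by norm_num)
    simp only [ENNReal.coe_ofNat, NNReal.coe_ofNat, ENNReal.rpow_ofNat] at this
    rw [this]
    refine lintegral_congr fun x => ?_
    rw [← ofReal_norm, ← ENNReal.ofReal_pow (norm_nonneg _), Real.norm_eq_abs, sq_abs]
  have hi : ∀ i j, Integrable fun x => c i * haar i x * (c j * haar j x) := fun i j => by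
    have := (integrable_haar_mul ((integrable_haar j).const_mul (c j)) i).const_mul (c i)
    simpa only [mul_assoc] using this
  have h2 : (fun x => (∑ i ∈ T, c i * haar i x) ^ 2)
      = fun x => ∑ i ∈ T, ∑ j ∈ T, c i * haar i x * (c j * haar j x) := by
    ext x
    rw [pow_two, Finset.sum_mul_sum]
  have h3 : Integrable fun x => (∑ i ∈ T, c i * haar i x) ^ 2 := by
    rw [h2]
    exact integrable_finsetSum T fun i _ => integrable_finsetSum T fun j _ => hi i j
  rw [h1, ← ofReal_integral_eq_lintegral_ofReal h3 (Eventually.of_forall fun x => sq_nonneg _), h2,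
    integral_finsetSum T fun i _ => integrable_finsetSum T fun j _ => hi i j,
    ← ENNReal.ofReal_sum_of_nonneg fun i _ => sq_nonneg _]
  congr 1
  refine Finset.sum_congr rfl fun i hiT => ?_
  rw [integral_finsetSum T fun j _ => hi i j]
  have : ∀ j, ∫ x, c i * haar i x * (c j * haar j x) = c i * c j * if i = j then 1 else 0 := by
    intro j
    rw [← integral_haar_mul_haar, ← integral_const_mul]
    congr 1
    ext x
    ring
  simp_rw [this]
  simp [hiT, pow_two]

/-! ### The estimator as a function of counts -/

lemma pointSum_eq_sum {S : Set ℝ} (hS : S.Finite) (g : ℝ → ℝ) :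
    pointSum S g = ∑ T ∈ hS.toFinset, g T := by
  obtain ⟨F, rfl⟩ := hS.exists_finset_coe
  rw [pointSum, Finset.finite_toSet_toFinset]
  exact Finset.tsum_subtype F g

lemma pointSum_indicator_one {S : Set ℝ} (hS : S.Finite) (A : Set ℝ) :
    pointSum S (A.indicator 1) = ((S ∩ A).ncard : ℝ) := by
  classical
  rw [pointSum_eq_sum hS, Finset.sum_indicator_eq_sum_filter]
  simp only [Pi.one_apply, Finset.sum_const, nsmul_eq_mul, mul_one, Nat.cast_inj]
  rw [← Set.ncard_coe_finset]
  congr 1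
  ext x
  simp

lemma pointSum_haar {S : Set ℝ} (hS : S.Finite) (l : HaarIndex) :
    pointSum S (haar l)
      = haarAmp l * (((S ∩ haarPos l).ncard : ℝ) - (S ∩ haarNeg l).ncard) := by
  rw [← pointSum_indicator_one hS, ← pointSum_indicator_one hS, pointSum_eq_sum hS,
    pointSum_eq_sum hS, pointSum_eq_sum hS, ← Finset.sum_sub_distrib, Finset.mul_sum]
  exact Finset.sum_congr rfl fun x _ => haar_eq l x

lemma pointSum_haar_sq {S : Set ℝ} (hS : S.Finite) (l : HaarIndex) :
    pointSum S (fun x => haar l x ^ 2)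
      = haarAmp l ^ 2 * (((S ∩ haarPos l).ncard : ℝ) + (S ∩ haarNeg l).ncard) := by
  rw [← pointSum_indicator_one hS, ← pointSum_indicator_one hS, pointSum_eq_sum hS,
    pointSum_eq_sum hS, pointSum_eq_sum hS, ← Finset.sum_add_distrib, Finset.mul_sum]
  refine Finset.sum_congr rfl fun x _ => ?_
  rw [haar_sq_eq, haarAmp_sq, ← haarPos_union_haarNeg,
    Set.indicator_union_of_disjoint (disjoint_haarPos_haarNeg l)]

lemma threshold_eq {n : ℕ} {γ : ℝ} {S : Set ℝ} (hS : S.Finite) (l : HaarIndex) :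
    threshold n γ S l = haarAmp l / n *
      countThreshold γ (Real.log n) (((S ∩ haarPos l).ncard : ℝ) + (S ∩ haarNeg l).ncard) := by
  have hA := haarAmp_pos l
  have hL : 0 ≤ Real.log n := Real.log_natCast_nonneg n
  set x : ℝ := ((S ∩ haarPos l).ncard : ℝ) + (S ∩ haarNeg l).ncard with hx
  have hx0 : 0 ≤ x := by positivity
  have h1 : vHat n S l = (haarAmp l / n) ^ 2 * x := by
    rw [vHat, pointSum_haar_sq hS]; ring
  have h2 : vTilde n γ S l = (haarAmp l / n) ^ 2 *
      (x + √(2 * γ * Real.log n * x) + 3 * γ * Real.log n) := by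
    rw [vTilde, haarSupNorm_eq, h1]
    have : 2 * γ * Real.log n * ((haarAmp l / n) ^ 2 * x) * (haarAmp l ^ 2 / (n : ℝ) ^ 2)
        = ((haarAmp l / n) ^ 2) ^ 2 * (2 * γ * Real.log n * x) := by ring
    rw [this, Real.sqrt_mul (by positivity), Real.sqrt_sq (by positivity)]
    ring
  rw [threshold, haarSupNorm_eq, h2, countThreshold]
  have : 2 * γ * ((haarAmp l / n) ^ 2 *
      (x + √(2 * γ * Real.log n * x) + 3 * γ * Real.log n)) * Real.log n
      = (haarAmp l / n) ^ 2 * (2 * γ *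
        (x + √(2 * γ * Real.log n * x) + 3 * γ * Real.log n) * Real.log n) := by ring
  rw [this, Real.sqrt_mul (by positivity), Real.sqrt_sq (by positivity)]
  ring

lemma betaHat_eq {n : ℕ} {S : Set ℝ} (hS : S.Finite) (l : HaarIndex) :
    betaHat n S l = haarAmp l / n *
      (((S ∩ haarPos l).ncard : ℝ) - (S ∩ haarNeg l).ncard) := by
  rw [betaHat, pointSum_haar hS]; ring

/-- The squared error of one thresholded coefficient in terms of the counts on the two halves of
the support. -/
lemma betaTilde_sub_sq_eq {n : ℕ} (hn : 0 < n) {γ : ℝ} {S : Set ℝ} (hS : S.Finite)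
    {l : HaarIndex} (hl : l ∈ haarGamma n) {f : ℝ → ℝ} (hf : Integrable f) :
    (betaTilde n γ S l - haarCoeff f l) ^ 2 = (haarAmp l / n) ^ 2 *
      countLoss γ (Real.log n) (n * (∫ x in haarPos l, f x) - n * ∫ x in haarNeg l, f x)
        ((S ∩ haarPos l).ncard, (S ∩ haarNeg l).ncard) := by
  have hn' : (0 : ℝ) < n := by exact_mod_cast hn
  have hA : 0 < haarAmp l / n := div_pos (haarAmp_pos l) hn'
  have hβ : haarCoeff f l = haarAmp l / n *
      (n * (∫ x in haarPos l, f x) - n * ∫ x in haarNeg l, f x) := by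
    rw [haarCoeff, integral_haar_mul_eq hf]; field_simp
  have hiff : threshold n γ S l ≤ |betaHat n S l| ↔
      countThreshold γ (Real.log n) (((S ∩ haarPos l).ncard : ℝ) + (S ∩ haarNeg l).ncard)
        ≤ |((S ∩ haarPos l).ncard : ℝ) - (S ∩ haarNeg l).ncard| := by
    rw [threshold_eq hS, betaHat_eq hS, abs_mul, abs_of_pos hA,
      mul_le_mul_iff_of_pos_left hA]
  rw [betaTilde, countLoss, hβ]
  simp only [hl, true_and, hiff]
  split_ifs
  · rw [betaHat_eq hS]; ring
  · ring

lemma finite_setOf_mem_support (J : ℤ) (x : ℝ) :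
    {l : HaarIndex | l.scale ≤ J ∧ x ∈ Set.Icc (haarLeft l) (haarRight l)}.Finite := by
  set B : ℝ := 2 ^ J.toNat * |x| with hB
  have hfin : (Set.Icc (-1 : ℤ) J ×ˢ Set.Icc (⌊-B - 1⌋) (⌈B⌉)).Finite :=
    (Set.finite_Icc _ _).prod (Set.finite_Icc _ _)
  refine (hfin.preimage (f := (Subtype.val : HaarIndex → ℤ × ℤ))
    Subtype.val_injective.injOn).subset ?_
  rintro l ⟨hJ, h1, h2⟩
  have hp : (0 : ℝ) < 2 ^ haarLevel l := by positivity
  rw [haarLeft, div_le_iff₀ hp] at h1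
  rw [haarRight, le_div_iff₀ hp] at h2
  have hlev : haarLevel l ≤ J.toNat := Int.toNat_le_toNat hJ
  have hxB : |x * 2 ^ haarLevel l| ≤ B := by
    rw [abs_mul, abs_of_pos hp, mul_comm, hB]
    gcongr
    norm_num
  have := abs_le.1 hxB
  refine ⟨⟨l.2, hJ⟩, ?_, ?_⟩
  · have h3 : (⌊-B - 1⌋ : ℝ) ≤ HaarIndex.shift l := (Int.floor_le _).trans (by linarith)
    exact_mod_cast h3
  · have h3 : (HaarIndex.shift l : ℝ) ≤ ⌈B⌉ := le_trans (by linarith) (Int.le_ceil B)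
    exact_mod_cast h3

lemma finite_betaTilde_ne_zero {S : Set ℝ} (hS : S.Finite) (n : ℕ) (γ : ℝ) :
    {l : HaarIndex | betaTilde n γ S l ≠ 0}.Finite := by
  refine (hS.biUnion fun x _ => finite_setOf_mem_support (Nat.log 2 n : ℤ) x).subset ?_
  intro l hl
  have hΓ : l ∈ haarGamma n := by
    by_contra h
    exact hl (by simp [betaTilde, h])
  have hb : betaHat n S l ≠ 0 := by
    intro h
    exact hl (by simp [betaTilde, h])
  have hex : ∃ x ∈ S, haar l x ≠ 0 := by
    by_contra! h
    apply hb
    rw [betaHat, pointSum_eq_sum hS, Finset.sum_eq_zero, mul_zero]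
    exact fun x hx => h x (hS.mem_toFinset.1 hx)
  obtain ⟨x, hxS, hx⟩ := hex
  have hx' : x ∈ Function.support (haar l) := hx
  rw [support_haar] at hx'
  exact Set.mem_biUnion hxS ⟨hΓ, hx'⟩

/-- Parseval's identity for the loss. -/
theorem haarLoss_eq_tsum {S : Set ℝ} (hS : S.Finite) (n : ℕ) (γ : ℝ) {f : ℝ → ℝ}
    (hf : Integrable f) (hβ : {l : HaarIndex | haarCoeff f l ≠ 0}.Finite) :
    haarLoss n γ f S
      = ∑' l : HaarIndex, ENNReal.ofReal ((betaTilde n γ S l - haarCoeff f l) ^ 2) := by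
  classical
  set T := (finite_betaTilde_ne_zero hS n γ).toFinset ∪ hβ.toFinset with hT
  have hT1 : ∀ l, l ∉ T → betaTilde n γ S l = 0 := fun l hl => by
    by_contra h
    exact hl (Finset.mem_union_left _ ((Set.Finite.mem_toFinset _).2 h))
  have hT2 : ∀ l, l ∉ T → haarCoeff f l = 0 := fun l hl => by
    by_contra h
    exact hl (Finset.mem_union_right _ ((Set.Finite.mem_toFinset _).2 h))
  have hae : (fun x => haarEstimator n γ S x - f x) =ᵐ[volume]
      fun x => ∑ l ∈ T, (betaTilde n γ S l - haarCoeff f l) * haar l x := by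
    filter_upwards [ae_eq_sum_haar hf hT2] with x hx
    rw [hx, haarEstimator, tsum_eq_sum (s := T) fun l hl => by rw [hT1 l hl, zero_mul],
      ← Finset.sum_sub_distrib]
    exact Finset.sum_congr rfl fun l _ => by ring
  rw [haarLoss, eLpNorm_congr_ae hae, eLpNorm_sum_haar_sq, tsum_eq_sum]
  intro l hl
  simp [hT1 l hl, hT2 l hl]

/-! ### Counts of a Poisson process -/

lemma lintegral_poissonMeasure (r : NNReal) (g : ℕ → ℝ≥0∞) :
    ∫⁻ i, g i ∂(poissonMeasure r) = ∑' i, ENNReal.ofReal (poissonWeight r i) * g i := by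
  rw [poissonMeasure, lintegral_sum_measure]
  simp [poissonWeight]

lemma lintegral_poissonLaw {a : ℝ} (ha : 0 ≤ a) (g : ℕ∞ → ℝ≥0∞) :
    ∫⁻ i, g i ∂(poissonLaw (ENNReal.ofReal a))
      = ∑' i : ℕ, ENNReal.ofReal (poissonWeight a i) * g i := by
  rw [poissonLaw, if_neg ENNReal.ofReal_ne_top, lintegral_map .of_discrete .of_discrete,
    lintegral_poissonMeasure]
  have : ((ENNReal.ofReal a).toNNReal : ℝ) = a := by
    rw [ENNReal.coe_toNNReal_eq_toReal, ENNReal.toReal_ofReal ha]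
  rw [this]

namespace IsPoissonProcess

variable {Ω X : Type*} [MeasurableSpace Ω] [MeasurableSpace X] {N : Ω → Set X} {μ : Measure X}
  {P : Measure Ω}

lemma ae_finite (hN : IsPoissonProcess N μ P) (hμ : μ Set.univ ≠ ∞) : ∀ᵐ ω ∂P, (N ω).Finite := by
  have hm := hN.measurable_count Set.univ .univ
  have h : P.map (fun ω => (N ω ∩ Set.univ).encard) {⊤} = 0 := by
    rw [hN.law_count _ .univ, poissonLaw, if_neg hμ, Measure.map_apply .of_discrete .of_discrete]
    have he : (fun k : ℕ => (k : ℕ∞)) ⁻¹' {⊤} = ∅ := by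
      ext k
      simp
    rw [he, measure_empty]
  rw [Measure.map_apply hm (measurableSet_singleton _)] at h
  filter_upwards [measure_eq_zero_iff_ae_notMem.1 h] with ω hω
  simpa [Set.encard_eq_top_iff, Set.not_infinite] using hω

lemma measurable_ncard (hN : IsPoissonProcess N μ P) {A : Set X} (hA : MeasurableSet A) :
    Measurable fun ω => (N ω ∩ A).ncard :=
  (Measurable.of_discrete (f := ENat.toNat)).comp (hN.measurable_count A hA)

lemma indepFun_encard (hN : IsPoissonProcess N μ P) {A B : Set X}
    (hA : MeasurableSet A) (hB : MeasurableSet B) (hAB : Disjoint A B) :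
    IndepFun (fun ω => (N ω ∩ A).encard) (fun ω => (N ω ∩ B).encard) P := by
  obtain ⟨C, hC0, hC1⟩ : ∃ C : Fin 2 → Set X, C 0 = A ∧ C 1 = B := ⟨![A, B], rfl, rfl⟩
  have hm : ∀ i, MeasurableSet (C i) := Fin.forall_fin_two.2 ⟨hC0 ▸ hA, hC1 ▸ hB⟩
  have hd : Pairwise fun i j => Disjoint (C i) (C j) := by
    intro i j hij
    rcases Fin.exists_fin_two.1 ⟨i, rfl⟩ with hi | hi <;>
    rcases Fin.exists_fin_two.1 ⟨j, rfl⟩ with hj | hj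
    · exact absurd (hi.trans hj.symm) hij
    · rw [hi, hj, hC0, hC1]
      exact hAB
    · rw [hi, hj, hC0, hC1]
      exact hAB.symm
    · exact absurd (hi.trans hj.symm) hij
  have h := (hN.indep_count 2 C hm hd).indepFun (i := 0) (j := 1) (by decide)
  rwa [hC0, hC1] at h

lemma lintegral_ncard [IsProbabilityMeasure P] (hN : IsPoissonProcess N μ P) {A B : Set X}
    (hA : MeasurableSet A) (hB : MeasurableSet B) (hAB : Disjoint A B) {a b : ℝ} (ha : 0 ≤ a)
    (hb : 0 ≤ b) (hμA : μ A = ENNReal.ofReal a) (hμB : μ B = ENNReal.ofReal b)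
    (G : ℕ × ℕ → ℝ≥0∞) :
    ∫⁻ ω, G ((N ω ∩ A).ncard, (N ω ∩ B).ncard) ∂P = poissonPairMean a b G := by
  have hind := hN.indepFun_encard hA hB hAB
  have hmA := hN.measurable_count A hA
  have hmB := hN.measurable_count B hB
  rw [indepFun_iff_map_prod_eq_prod_map_map hmA.aemeasurable hmB.aemeasurable,
    hN.law_count A hA, hN.law_count B hB, hμA, hμB] at hind
  have hprob : IsProbabilityMeasure (poissonLaw (ENNReal.ofReal b)) := by
    rw [← hμB, ← hN.law_count B hB]
    exact Measure.isProbabilityMeasure_map hmB.aemeasurable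
  have hG : Measurable fun c : ℕ∞ × ℕ∞ => G (c.1.toNat, c.2.toNat) := .of_discrete
  have h1 : ∫⁻ ω, G ((N ω ∩ A).ncard, (N ω ∩ B).ncard) ∂P
      = ∫⁻ c : ℕ∞ × ℕ∞, G (c.1.toNat, c.2.toNat)
        ∂(P.map fun ω => ((N ω ∩ A).encard, (N ω ∩ B).encard)) := by
    rw [lintegral_map hG (hmA.prodMk hmB)]
    simp only [Set.ncard_def]
  rw [h1, hind, lintegral_prod _ hG.aemeasurable, lintegral_poissonLaw ha,
    poissonPairMean, ENNReal.tsum_prod']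
  refine tsum_congr fun i => ?_
  rw [lintegral_poissonLaw hb, ← ENNReal.tsum_mul_left]
  refine tsum_congr fun k => ?_
  rw [ENNReal.ofReal_mul (poissonWeight_nonneg ha i), mul_assoc]
  simp only [ENat.toNat_natCast]

end IsPoissonProcess

lemma intensityMeasure_apply {f : ℝ → ℝ} (hf : Integrable f) (hf0 : 0 ≤ᵐ[volume] f) (n : ℕ)
    {A : Set ℝ} (hA : MeasurableSet A) :
    intensityMeasure n f A = ENNReal.ofReal (n * ∫ x in A, f x) := by
  rw [intensityMeasure, withDensity_apply _ hA, ← integral_const_mul,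
    ofReal_integral_eq_lintegral_ofReal (hf.const_mul (n : ℝ)).integrableOn]
  refine ae_restrict_of_ae ?_
  filter_upwards [hf0] with x hx
  exact mul_nonneg (Nat.cast_nonneg n) hx

/-! ### Consequences of membership in the class -/

section Class

variable {n : ℕ} {R : ℝ} {f : ℝ → ℝ}

lemma integrable_of_mem_haarClass (hf : f ∈ haarClass n R) : Integrable f :=
  memLp_one_iff_integrable.1 hf.2.1.1

lemma ae_le_of_mem_haarClass (hR : 0 ≤ R) (hf : f ∈ haarClass n R) : ∀ᵐ x, f x ≤ R := by
  have h := hf.2.2.2.1.2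
  rw [eLpNorm_exponent_top] at h
  filter_upwards [ae_le_eLpNormEssSup (f := f) (μ := volume)] with x hx
  have h1 := hx.trans h
  rw [← ofReal_norm, ENNReal.ofReal_le_ofReal_iff hR] at h1
  exact (le_abs_self _).trans h1

lemma haarMass_nonneg (hf : f ∈ haarClass n R) (l : HaarIndex) : 0 ≤ haarMass f l :=
  integral_nonneg_of_ae (ae_restrict_of_ae hf.1)

lemma haarMass_le (hR : 0 ≤ R) (hf : f ∈ haarClass n R) (l : HaarIndex) :
    2 ^ haarLevel l * haarMass f l ≤ R := by
  have hp : (0 : ℝ) < 2 ^ haarLevel l := by positivity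
  have h : haarMass f l ≤ ∫ _ in Set.Icc (haarLeft l) (haarRight l), R := by
    rw [haarMass, support_haar]
    refine setIntegral_mono_ae (integrable_of_mem_haarClass hf).integrableOn
      (integrableOn_const (by simp)) ?_
    filter_upwards [ae_le_of_mem_haarClass hR hf] with x hx using hx
  rw [setIntegral_const, smul_eq_mul, Real.volume_real_Icc_of_le (haarLeft_lt_haarRight l).le,
    haarRight_sub_haarLeft] at h
  calc _ ≤ 2 ^ haarLevel l * ((2 ^ haarLevel l)⁻¹ * R) := by gcongr
    _ = R := by field_simp

/-- Above the finest scale of the estimator, the functions of the class have no Haar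
coefficients. -/
lemma haarCoeff_eq_zero_of_notMem (hn : 0 < n) (hR : 0 < R)
    (hlog : R ≤ Real.log n * Real.log (Real.log n)) (hf : f ∈ haarClass n R) {l : HaarIndex}
    (hl : l ∉ haarGamma n) : haarCoeff f l = 0 := by
  by_contra h
  have hn' : (0 : ℝ) < n := by exact_mod_cast hn
  have h1 := hf.2.2.2.2 l h
  rw [div_le_iff₀ hn'] at h1
  have h2 := haarMass_le hR.le hf l
  have h3 : (n : ℝ) < 2 ^ haarLevel l := by
    have h4 : Nat.log 2 n < haarLevel l := by
      have h5 : ¬ l.scale ≤ (Nat.log 2 n : ℤ) := hl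
      unfold haarLevel
      omega
    exact_mod_cast Nat.lt_pow_of_log_lt (by norm_num) h4
  have h6 : 0 < haarMass f l := by
    by_contra! h0
    nlinarith
  nlinarith

lemma two_pow_haarLevel_le (hn : 0 < n) {l : HaarIndex} (hl : l ∈ haarGamma n) :
    (2 : ℝ) ^ haarLevel l ≤ n := by
  have h : haarLevel l ≤ Nat.log 2 n := by
    have : l.scale ≤ (Nat.log 2 n : ℤ) := hl
    unfold haarLevel
    omega
  exact_mod_cast Nat.pow_le_of_le_log hn.ne' h

lemma tsum_measure_dyadic_le (μ : Measure ℝ) (j : ℕ) :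
    ∑' k : ℤ, μ (Set.Ioc ((k : ℝ) / 2 ^ j) ((k + 1) / 2 ^ j)) ≤ μ Set.univ := by
  refine (tsum_meas_le_meas_iUnion_of_disjoint μ (fun _ => measurableSet_Ioc) ?_).trans
    (measure_mono (Set.subset_univ _))
  have key : ∀ k k' : ℤ, k < k' → ∀ x : ℝ, x ≤ (k + 1) / 2 ^ j → ¬ (k' : ℝ) / 2 ^ j < x := by
    intro k k' h x hx
    have h1 : ((k + 1 : ℤ) : ℝ) ≤ k' := by exact_mod_cast h
    push_cast at h1
    exact not_lt.2 (hx.trans (by gcongr))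
  intro k k' hne
  refine Set.disjoint_left.2 fun x hx hx' => ?_
  rcases lt_or_gt_of_ne hne with h | h
  · exact key k k' h x hx.2 hx'.1
  · exact key k' k h x hx'.2 hx.1

lemma intensityMeasure_one_univ_le (hf : f ∈ haarClass n R) :
    intensityMeasure 1 f Set.univ ≤ ENNReal.ofReal R := by
  refine le_trans ?_ hf.2.1.2
  rw [intensityMeasure, withDensity_apply _ .univ, eLpNorm_one_eq_lintegral_enorm,
    Measure.restrict_univ]
  refine lintegral_mono fun x => ?_
  rw [← ofReal_norm, Nat.cast_one, one_mul, Real.norm_eq_abs]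
  exact ENNReal.ofReal_le_ofReal (le_abs_self (f x))

lemma ofReal_haarMass_eq (hf : f ∈ haarClass n R) (l : HaarIndex) :
    ENNReal.ofReal (haarMass f l)
      = intensityMeasure 1 f (Set.Ioc (haarLeft l) (haarRight l)) := by
  have h1 : intensityMeasure 1 f (Set.Icc (haarLeft l) (haarRight l))
      = ENNReal.ofReal (haarMass f l) := by
    rw [intensityMeasure_apply (integrable_of_mem_haarClass hf) hf.1 1 measurableSet_Icc,
      Nat.cast_one, one_mul, haarMass, support_haar]
  have hac : intensityMeasure 1 f ≪ volume := withDensity_absolutelyContinuous _ _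
  rw [← h1]
  exact (measure_congr (hac.ae_eq Ioc_ae_eq_Icc)).symm

lemma tsum_haarMass_le (hf : f ∈ haarClass n R) :
    ∑' l : haarGamma n, ENNReal.ofReal (haarMass f l)
      ≤ ((Nat.log 2 n + 2 : ℕ) : ℝ≥0∞) * ENNReal.ofReal R := by
  obtain ⟨J, hJ⟩ : ∃ J : Finset ℤ, J = Finset.Icc (-1) (Nat.log 2 n : ℤ) := ⟨_, rfl⟩
  have hcard : J.card = Nat.log 2 n + 2 := by
    have h : ∀ k : ℕ, (Finset.Icc (-1) (k : ℤ)).card = k + 2 := fun k => by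
      rw [Int.card_Icc]
      omega
    rw [hJ, h]
  let e : haarGamma n → J × ℤ := fun l =>
    (⟨l.1.scale, hJ ▸ Finset.mem_Icc.2 ⟨l.1.2, l.2⟩⟩, l.1.shift)
  have hinj : Function.Injective e := by
    intro l l' h
    have h1 : l.1.scale = l'.1.scale := congrArg (fun p : J × ℤ => (p.1 : ℤ)) h
    have h2 : l.1.shift = l'.1.shift := congrArg (fun p : J × ℤ => p.2) h
    exact Subtype.ext (Subtype.ext (Prod.ext h1 h2))
  let m : J × ℤ → ℝ≥0∞ := fun p => intensityMeasure 1 f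
    (Set.Ioc ((p.2 : ℝ) / 2 ^ p.1.1.toNat) ((p.2 + 1) / 2 ^ p.1.1.toNat))
  have hm : ∀ j : J, ∑' k : ℤ, m (j, k) ≤ ENNReal.ofReal R := by
    intro j
    have h := tsum_measure_dyadic_le (intensityMeasure 1 f) j.1.toNat
    exact h.trans (intensityMeasure_one_univ_le hf)
  calc ∑' l : haarGamma n, ENNReal.ofReal (haarMass f l) = ∑' l, m (e l) :=
        tsum_congr fun l => ofReal_haarMass_eq hf l
    _ ≤ ∑' p, m p := ENNReal.tsum_comp_le_tsum_of_injective hinj m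
    _ = ∑ j : J, ∑' k : ℤ, m (j, k) := by rw [ENNReal.tsum_prod', tsum_fintype]
    _ ≤ ∑ _j : J, ENNReal.ofReal R :=
        Finset.sum_le_sum fun j _ => hm j
    _ = _ := by
        rw [Finset.sum_const, nsmul_eq_mul, Finset.card_univ, Fintype.card_coe, hcard]

lemma summable_haarMass (hf : f ∈ haarClass n R) :
    Summable fun l : haarGamma n => haarMass f l := by
  have h := ENNReal.summable_toReal (ne_top_of_le_ne_top
    (ENNReal.mul_ne_top (ENNReal.natCast_ne_top _) ENNReal.ofReal_ne_top) (tsum_haarMass_le hf))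
  simpa only [ENNReal.toReal_ofReal (haarMass_nonneg hf _)] using h

lemma tsum_real_haarMass_le (hR : 0 ≤ R) (hf : f ∈ haarClass n R) :
    ∑' l : haarGamma n, haarMass f l ≤ (Nat.log 2 n + 2) * R := by
  have h := tsum_haarMass_le hf
  rw [← ENNReal.ofReal_tsum_of_nonneg (fun l => haarMass_nonneg hf _) (summable_haarMass hf),
    ← ENNReal.ofReal_natCast, ← ENNReal.ofReal_mul (by positivity),
    ENNReal.ofReal_le_ofReal_iff (by positivity)] at h
  exact_mod_cast h

lemma finite_haarCoeff_ne_zero (hn : 0 < n) (hR : 0 < R)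
    (hlog : R ≤ Real.log n * Real.log (Real.log n)) (hf : f ∈ haarClass n R) :
    {l : HaarIndex | haarCoeff f l ≠ 0}.Finite := by
  have hn' : (0 : ℝ) < n := by exact_mod_cast hn
  set c := Real.log n * Real.log (Real.log n) / n with hc
  have hc0 : 0 < c := div_pos (hR.trans_le hlog) hn'
  have h := (summable_haarMass hf).tendsto_cofinite_zero.eventually (gt_mem_nhds hc0)
  have hfin : {l : haarGamma n | ¬ haarMass f l < c}.Finite := h
  refine (hfin.image Subtype.val).subset fun l hl => ?_
  have hlΓ : l ∈ haarGamma n := by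
    by_contra h0
    exact hl (haarCoeff_eq_zero_of_notMem hn hR hlog hf h0)
  exact ⟨⟨l, hlΓ⟩, not_lt.2 (hf.2.2.2.2 l hl), rfl⟩

lemma haarVar_eq (hn : 0 < n) (l : HaarIndex) :
    haarVar n f l = (haarAmp l / n) ^ 2 * (n * haarMass f l) := by
  have hn' : (n : ℝ) ≠ 0 := by positivity
  rw [haarVar, integral_haar_sq_mul_eq, div_pow, haarAmp_sq]
  field_simp

lemma haarVar_le_haarMass (hn : 0 < n) (hf : f ∈ haarClass n R) {l : HaarIndex}
    (hl : l ∈ haarGamma n) : haarVar n f l ≤ haarMass f l := by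
  have hn' : (0 : ℝ) < n := by exact_mod_cast hn
  have h := mul_le_mul_of_nonneg_right (two_pow_haarLevel_le hn hl) (haarMass_nonneg hf l)
  rw [haarVar, integral_haar_sq_mul_eq, one_div, inv_mul_le_iff₀ hn']
  exact h

lemma haarVar_nonneg (hf : f ∈ haarClass n R) (l : HaarIndex) : 0 ≤ haarVar n f l := by
  rw [haarVar, integral_haar_sq_mul_eq]
  have := haarMass_nonneg hf l
  positivity

lemma min_haarCoeff_haarVar_nonneg (hf : f ∈ haarClass n R) (l : HaarIndex) :
    0 ≤ min (haarCoeff f l ^ 2) (haarVar n f l) :=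
  le_min (sq_nonneg _) (haarVar_nonneg hf l)

lemma summable_min_haarCoeff_haarVar (hn : 0 < n) (hf : f ∈ haarClass n R) :
    Summable fun l : haarGamma n => min (haarCoeff f l ^ 2) (haarVar n f l) :=
  (summable_haarMass hf).of_nonneg_of_le (fun l => min_haarCoeff_haarVar_nonneg hf l)
    fun l => (min_le_right _ _).trans (haarVar_le_haarMass hn hf l.2)

end Class

/-! ### The risk bound -/

lemma eventually_remainder_le (K : ℝ) :
    ∀ᶠ n : ℕ in atTop, K * Real.exp (-(3 / 2) * Real.log n) * (Nat.log 2 n + 2)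
      ≤ 12 * Real.log n * (1 / n) := by
  have hlog : Tendsto (fun n : ℕ => Real.log n) atTop atTop :=
    Real.tendsto_log_atTop.comp tendsto_natCast_atTop_atTop
  have h0 : Tendsto (fun n : ℕ => |K| * Real.exp (-(Real.log n / 2))) atTop (nhds 0) := by
    have := (Real.tendsto_exp_neg_atTop_nhds_zero.comp
      (hlog.atTop_div_const (show (0 : ℝ) < 2 by norm_num))).const_mul |K|
    simpa using this
  filter_upwards [h0.eventually (gt_mem_nhds (show (0 : ℝ) < 3 by norm_num)),
    hlog.eventually_ge_atTop 1, eventually_gt_atTop 0] with n h1 h2 hn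
  have hn' : (0 : ℝ) < n := by exact_mod_cast hn
  have h3 : (Nat.log 2 n : ℝ) + 2 ≤ 4 * Real.log n := by
    have h4 : ((2 ^ Nat.log 2 n : ℕ) : ℝ) ≤ n := by exact_mod_cast Nat.pow_log_le_self 2 hn.ne'
    have h5 := Real.log_le_log (by positivity) h4
    push_cast at h5
    rw [Real.log_pow] at h5
    have h6 : (1 / 2 : ℝ) ≤ Real.log 2 := by linarith [Real.log_two_gt_d9]
    have h7 : (0 : ℝ) ≤ Nat.log 2 n := by positivity
    nlinarith
  have h8 : Real.exp (-(3 / 2) * Real.log n) = 1 / n * Real.exp (-(Real.log n / 2)) := by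
    have h9 : -(3 / 2) * Real.log n = -Real.log n + -(Real.log n / 2) := by ring
    rw [h9, Real.exp_add, Real.exp_neg (Real.log n), Real.exp_log hn', one_div]
  rw [h8]
  calc K * (1 / n * Real.exp (-(Real.log n / 2))) * (Nat.log 2 n + 2)
      ≤ |K| * (1 / n * Real.exp (-(Real.log n / 2))) * (4 * Real.log n) := by
        have := le_abs_self K
        gcongr
    _ = (|K| * Real.exp (-(Real.log n / 2))) * (4 * Real.log n) * (1 / n) := by ring
    _ ≤ 3 * (4 * Real.log n) * (1 / n) := by gcongr
    _ = _ := by ring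

/-- The loss in terms of the counts on the halves of the supports. -/
lemma haarLoss_eq_tsum_countLoss {n : ℕ} {R γ : ℝ} {f : ℝ → ℝ} (hn : 0 < n) (hR : 0 < R)
    (hlog : R ≤ Real.log n * Real.log (Real.log n)) (hf : f ∈ haarClass n R) {S : Set ℝ}
    (hS : S.Finite) :
    haarLoss n γ f S = ∑' l : haarGamma n, ENNReal.ofReal ((haarAmp l / n) ^ 2 *
      countLoss γ (Real.log n) (n * (∫ x in haarPos l, f x) - n * ∫ x in haarNeg l, f x)
        ((S ∩ haarPos l).ncard, (S ∩ haarNeg l).ncard)) := by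
  have hfi := integrable_of_mem_haarClass hf
  rw [haarLoss_eq_tsum hS n γ hfi (finite_haarCoeff_ne_zero hn hR hlog hf),
    ← tsum_subtype_eq_of_support_subset (s := haarGamma n)]
  · exact tsum_congr fun l => by rw [betaTilde_sub_sq_eq hn hS l.2 hfi]
  · intro l hl
    by_contra h
    apply hl
    simp [haarCoeff_eq_zero_of_notMem hn hR hlog hf h, betaTilde, h]

lemma exists_poissonPairMean_coefficient_loss_le :
    ∃ C : ℝ, 0 ≤ C ∧ ∀ (R : ℝ) (n : ℕ) (f : ℝ → ℝ), 0 ≤ R → 10 ≤ Real.log n →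
      1000 ≤ Real.log (Real.log n) → f ∈ haarClass n R → ∀ (l : haarGamma n),
      poissonPairMean (n * ∫ x in haarPos l, f x) (n * ∫ x in haarNeg l, f x)
        (fun p => ENNReal.ofReal ((haarAmp l / n) ^ 2 * countLoss (1 + √2) (Real.log n)
          (n * (∫ x in haarPos l, f x) - n * ∫ x in haarNeg l, f x) p)) ≤
      ENNReal.ofReal (12 * Real.log n * min (haarCoeff f l ^ 2) (haarVar n f l)
        + C * Real.exp (-(3 / 2) * Real.log n) * (1 + R) * haarMass f l) := by
  obtain ⟨C, hC0, hC⟩ := exists_poissonPairMean_countLoss_le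
  refine ⟨C, hC0, fun R n f hR hL hLL hf l => ?_⟩
  have hn : 0 < n := by
    rcases Nat.eq_zero_or_pos n with rfl | h
    · norm_num at hL
    · exact h
  have hn' : (0 : ℝ) < n := by exact_mod_cast hn
  have hfi := integrable_of_mem_haarClass hf
  have hF := haarMass_eq_add hfi l.1
  have hF0 := haarMass_nonneg hf l.1
  set a := n * ∫ x in haarPos l, f x with ha
  set b := n * ∫ x in haarNeg l, f x with hb
  have ha0 : 0 ≤ a := mul_nonneg hn'.le (integral_nonneg_of_ae (ae_restrict_of_ae hf.1))
  have hb0 : 0 ≤ b := mul_nonneg hn'.le (integral_nonneg_of_ae (ae_restrict_of_ae hf.1))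
  have hab : a + b = n * haarMass f l := by rw [hF, ha, hb]; ring
  have hβ : haarCoeff f l = haarAmp l / n * (a - b) := by
    rw [haarCoeff, integral_haar_mul_eq hfi, ha, hb]; field_simp
  have hA : 0 < haarAmp l / n := div_pos (haarAmp_pos l) hn'
  have hlarge : a - b ≠ 0 → 1000 * Real.log n ≤ a + b := by
    intro h
    have h1 := hf.2.2.2.2 l.1 (by rw [hβ]; exact mul_ne_zero hA.ne' h)
    rw [div_le_iff₀ hn'] at h1
    nlinarith
  have hkey := hC (Real.log n) a b hL ha0 hb0 hlarge
  have hscale : poissonPairMean a b (fun p => ENNReal.ofReal ((haarAmp l / n) ^ 2 *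
      countLoss (1 + √2) (Real.log n) (a - b) p)) = ENNReal.ofReal ((haarAmp l / n) ^ 2) *
      poissonPairMean a b (fun p => ENNReal.ofReal
        (countLoss (1 + √2) (Real.log n) (a - b) p)) := by
    simp only [poissonPairMean]
    rw [← ENNReal.tsum_mul_left]
    refine tsum_congr fun p => ?_
    rw [ENNReal.ofReal_mul (sq_nonneg _), mul_left_comm]
  have hmin : min (haarCoeff f l ^ 2) (haarVar n f l)
      = (haarAmp l / n) ^ 2 * min ((a - b) ^ 2) (a + b) := by
    rw [haarVar_eq hn, hβ, mul_pow, hab, mul_min_of_nonneg _ _ (by positivity)]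
  rw [hscale]
  refine (mul_le_mul_right hkey _).trans ?_
  rw [← ENNReal.ofReal_mul (by positivity)]
  apply ENNReal.ofReal_le_ofReal
  rw [hmin]
  have h1 : (haarAmp l / n) ^ 2 * (a + b) ≤ haarMass f l := by
    rw [hab, ← haarVar_eq hn]
    exact haarVar_le_haarMass hn hf l.2
  have h2 : (haarAmp l / n) ^ 2 * (a + b) ^ 2 ≤ R * haarMass f l := by
    have h3 := mul_le_mul_of_nonneg_right (haarMass_le hR hf l.1) hF0
    have h4 : (haarAmp l / n) ^ 2 * (a + b) ^ 2 = 2 ^ haarLevel l.1 * haarMass f l * haarMass f l := by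
      rw [hab, div_pow, haarAmp_sq]; field_simp
    rw [h4]
    exact h3
  have h5 : 0 ≤ C * Real.exp (-(3 / 2) * Real.log n) := by positivity
  nlinarith [mul_le_mul_of_nonneg_left (add_le_add h1 h2) h5]

theorem theorem2 (R : ℝ) (hR : 0 < R) :
    ∀ᶠ n : ℕ in atTop, ∀ f ∈ haarClass n R,
      Summable (fun l : haarGamma n => min (haarCoeff f l ^ 2) (haarVar n f l)) ∧
      ∀ (Ω : Type*) [MeasurableSpace Ω] (P : Measure Ω) [IsProbabilityMeasure P]
        (N : Ω → Set ℝ), IsPoissonProcess N (intensityMeasure n f) P →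
        AEMeasurable (fun ω => haarLoss n (1 + √2) f (N ω)) P ∧
        ∫⁻ ω, haarLoss n (1 + √2) f (N ω) ∂P ≤
          ENNReal.ofReal (12 * Real.log n *
            ((∑' l : haarGamma n, min (haarCoeff f l ^ 2) (haarVar n f l)) + 1 / (n : ℝ))) := by
  obtain ⟨C, hC0, hC⟩ := exists_poissonPairMean_coefficient_loss_le
  have hlog : Tendsto (fun n : ℕ => Real.log n) atTop atTop :=
    Real.tendsto_log_atTop.comp tendsto_natCast_atTop_atTop
  have hloglog := Real.tendsto_log_atTop.comp hlog
  filter_upwards [hlog.eventually_ge_atTop 10, hloglog.eventually_ge_atTop 1000,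
    hlog.eventually_ge_atTop R, eventually_gt_atTop 0,
    eventually_remainder_le (C * (1 + R) * R)] with n hL hLL hLR hn hrem f hf
  simp only [Function.comp_apply] at hLL
  have hRlog : R ≤ Real.log n * Real.log (Real.log n) := by nlinarith
  have hsum := summable_min_haarCoeff_haarVar hn hf
  refine ⟨hsum, fun Ω _ P _ N hN => ?_⟩
  have hfi := integrable_of_mem_haarClass hf
  have hfin : ∀ᵐ ω ∂P, (N ω).Finite := hN.ae_finite (by
    rw [intensityMeasure_apply hfi hf.1 n .univ]
    exact ENNReal.ofReal_ne_top)
  set G : haarGamma n → ℕ × ℕ → ℝ≥0∞ := fun l p =>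
    ENNReal.ofReal ((haarAmp l / n) ^ 2 * countLoss (1 + √2) (Real.log n)
      (n * (∫ x in haarPos l, f x) - n * ∫ x in haarNeg l, f x) p) with hG
  have hae : (fun ω => haarLoss n (1 + √2) f (N ω)) =ᵐ[P]
      fun ω => ∑' l, G l ((N ω ∩ haarPos l).ncard, (N ω ∩ haarNeg l).ncard) := by
    filter_upwards [hfin] with ω hω
    exact haarLoss_eq_tsum_countLoss hn hR hRlog hf hω
  have hmeas : ∀ l : haarGamma n,
      Measurable fun ω => G l ((N ω ∩ haarPos l).ncard, (N ω ∩ haarNeg l).ncard) := fun l =>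
    (Measurable.of_discrete (f := G l)).comp
      ((hN.measurable_ncard (measurableSet_haarPos l)).prodMk
        (hN.measurable_ncard (measurableSet_haarNeg l)))
  refine ⟨⟨_, Measurable.tsum hmeas, hae⟩, ?_⟩
  rw [lintegral_congr_ae hae, lintegral_tsum fun l => (hmeas l).aemeasurable]
  set K := C * Real.exp (-(3 / 2) * Real.log n) * (1 + R) with hK
  have hK0 : 0 ≤ K := by positivity
  have hterm : ∀ l : haarGamma n,
      ∫⁻ ω, G l ((N ω ∩ haarPos l).ncard, (N ω ∩ haarNeg l).ncard) ∂P ≤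
        ENNReal.ofReal (12 * Real.log n * min (haarCoeff f l ^ 2) (haarVar n f l)
          + K * haarMass f l) := by
    intro l
    rw [hN.lintegral_ncard (measurableSet_haarPos l) (measurableSet_haarNeg l)
      (disjoint_haarPos_haarNeg l)
      (mul_nonneg (Nat.cast_nonneg n) (integral_nonneg_of_ae (ae_restrict_of_ae hf.1)))
      (mul_nonneg (Nat.cast_nonneg n) (integral_nonneg_of_ae (ae_restrict_of_ae hf.1)))
      (intensityMeasure_apply hfi hf.1 n (measurableSet_haarPos l))
      (intensityMeasure_apply hfi hf.1 n (measurableSet_haarNeg l))]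
    exact hC R n f hR.le hL hLL hf l
  refine (ENNReal.tsum_le_tsum hterm).trans ?_
  have hs := (hsum.mul_left (12 * Real.log n)).add ((summable_haarMass hf).mul_left K)
  rw [← ENNReal.ofReal_tsum_of_nonneg _ hs]
  · apply ENNReal.ofReal_le_ofReal
    rw [(hsum.mul_left (12 * Real.log n)).tsum_add ((summable_haarMass hf).mul_left K),
      tsum_mul_left, tsum_mul_left, mul_add]
    have h1 := mul_le_mul_of_nonneg_left (tsum_real_haarMass_le hR.le hf) hK0
    have h2 : K * ((Nat.log 2 n + 2) * R)
        = C * (1 + R) * R * Real.exp (-(3 / 2) * Real.log n) * (Nat.log 2 n + 2) := by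
      rw [hK]; ring
    linarith
  · intro l
    have h1 := min_haarCoeff_haarVar_nonneg hf l.1
    have h2 := haarMass_nonneg hf l.1
    have h3 : 0 ≤ 12 * Real.log n := by linarith
    exact add_nonneg (mul_nonneg h3 h1) (mul_nonneg hK0 h2)
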